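/- **Setting.** Let $M$ be a smooth finite-dimensional manifold without boundary, with a pseudo-Riemannian metric $\bar g$, its cometric $\tilde g(\omega,\eta)=\bar g(\sharp_{\bar g}\omega,\sharp_{\bar g}\eta)$ on $T^*M$, and a bivector field $\Pi$ with anchor $\eta(\sharp_\Pi\omega)=\Pi(\omega,\eta)$, bracket $[\omega,\eta]_\Pi=\mathcal L_{\sharp_\Pi\omega}\eta-\mathcal L_{\sharp_\Pi\eta}\omega-d(\Pi(\omega,\eta))$ and endomorphism $J$ of $T^*M$ given by $\tilde g(J\omega,\eta)=\Pi(\omega,\eta)$. Let $\mathcal D$ be the contravariant Levi-Civita connection of $(\tilde g,\Pi)$, i.e. the one with $\mathcal D_\omega\eta-\mathcal D_\eta\omega=[\omega,\eta]_\Pi$ and $\sharp_\Pi(\omega)\tilde g(\eta,\gamma)=\tilde g(\mathcal D_\omega\eta,\gamma)+\tilde g(\eta,\mathcal D_\omega\gamma)$. Put $\mathcal R(\omega,\eta)\gamma=\mathcal D_\omega\mathcal D_\eta\gamma-\mathcal D_\eta\mathcal D_\omega\gamma-\mathcal D_{[\omega,\eta]_\Pi}\gamma$, $$\mathcal K(\omega,\eta)=\frac{\tilde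 g(\mathcal R(\omega,\eta)\eta,\omega)}{\tilde g(\omega,\omega)\tilde g(\eta,\eta)-\tilde g(\omega,\eta)^2},\qquad H^u(\omega,\eta)=\tilde g(\mathcal D_\omega J\,du,\eta).$$ Let $(M_1,\bar g_1,\Pi_1)$ and $(M_2,\bar g_2,\Pi_2)$ be Poisson manifolds with pseudo-Riemannian metrics of indices $q_1,q_2$ and dimensions $k_1,k_2$, let $f_1>0$ be a smooth function on $M_1$ and $\nu_1\in C^\infty(M_1)$. The contravariant warped product is $M=M_1\times M_2$ with the cometric $\tilde g^{f_1}$ of $\bar g^{f_1}=\pi_1^*\bar g_1+(f_1\circ\pi_1)^2\pi_2^*\bar g_2$ and $\Pi^{\nu_1}=\Pi_1+\nu_1\Pi_2$; $\mathcal K^{M}$ and $\mathcal K^{M_1}$ denote the curvatures $\mathcal K$ of $M$ and $M_1$, and $J_1$, $H_1^{f_1}$ the objects $J$, $H^{f_1}$ of $M_1$. For $p=(p_1,p_2)\in M$, a $\tilde g_1$-orthonormal basis $dx_1,\dots,dx_{k_1}$ of $T^*_{p_1}M_1$ with exactly the first $q_1$ members timelike and a $\tilde g_2$-orthonormal basis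 $dy_1,\dots,dy_{k_2}$ of $T^*_{p_2}M_2$ with exactly the first $q_2$ members timelike, put $X_i=\pi_1^*dx_i$, $Y_j=f_1(p_1)\,\pi_2^*dy_j$. The qualar curvature of $M$ at $p$ is $$\mathcal Q(p)=2\sum_{i\le q_1<s\le k_1}\mathcal K^M(X_i,X_s)+2\sum_{i\le q_1}\ \sum_{q_2<s\le k_2}\mathcal K^M(X_i,Y_s)+2\sum_{i\le q_2}\ \sum_{q_1<s\le k_1}\mathcal K^M(Y_i,X_s)+2\sum_{i\le q_2<s\le k_2}\mathcal K^M(Y_i,Y_s).$$ **Corollary 4.4.** If $\nu_1$ is constant and $M_2$ is Riemannian, then the qualar curvature of $M$ at $p=(p_1,p_2)$ is $$\mathcal Q(p)=2\sum_{i=1}^{q_1}\sum_{s=q_1+1}^{k_1}\mathcal K^{M_1}(dx_i,dx_s)+\frac{2k_2}{f_1(p_1)}\sum_{i=1}^{q_1}H_1^{f_1}(dx_i,dx_i)+\frac{4k_2}{f_1(p_1)^2}\sum_{i=1}^{q_1}\bigl|\tilde g_1(J_1df_1,dx_i)\bigr|^2 ,$$ the right-hand side being evaluated at $p_1$. In particular,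 for given $(M_1,\bar g_1,\Pi_1)$, $f_1$, $p_1$ and $(dx_i)$, it does not depend on $\bar g_2$, $\Pi_2$, the point $p_2$, the basis $(dy_j)$ or the constant $\nu_1$; it depends on $M_2$ only through the dimension $k_2$. -/

import Mathlib

open scoped Manifold ContDiff Topology

noncomputable section

namespace ContravariantGeometry

/-! ## Linear algebra of a metric and a bivector on one tangent space

A metric on `T` is given by its musical map `g : T → T*`, `v ↦ g(v, ·)`.  A bivector `Π` on `T` is
given by its sharp (anchor) map `P = ♯_Π : T* → T`, where `η (♯_Π α) = Π(α, η)`. -/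

section Pointwise

variable {T : Type*} [AddCommGroup T] [Module ℝ T] [TopologicalSpace T]

/-- The musical isomorphism `♯_g : T* → T`, inverse to `v ↦ g(v, ·)`. -/
def musicalSharp (g : T →L[ℝ] T →L[ℝ] ℝ) : (T →L[ℝ] ℝ) →L[ℝ] T := g.inverse

/-- The cometric `g̃(α, η) = g(♯_g α, ♯_g η)`. -/
def cometric (g : T →L[ℝ] T →L[ℝ] ℝ) (α η : T →L[ℝ] ℝ) : ℝ :=
  g (musicalSharp g α) (musicalSharp g η)

/-- The value `Π(α, η) = η (♯_Π α)` of the bivector with sharp map `P`. -/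
def bivector (P : (T →L[ℝ] ℝ) →L[ℝ] T) (α η : T →L[ℝ] ℝ) : ℝ := η (P α)

/-- The endomorphism `J` of `T*` with `g̃(J α, η) = Π(α, η)`: see `cometric_endoJ`. -/
def endoJ (g : T →L[ℝ] T →L[ℝ] ℝ) (P : (T →L[ℝ] ℝ) →L[ℝ] T) (α : T →L[ℝ] ℝ) : T →L[ℝ] ℝ :=
  g (P α)

theorem musicalSharp_apply {g : T →L[ℝ] T →L[ℝ] ℝ} (hg : g.IsInvertible) (v : T) :
    musicalSharp g (g v) = v := by
  obtain ⟨e, rfl⟩ := hg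
  simp [musicalSharp]

theorem apply_musicalSharp {g : T →L[ℝ] T →L[ℝ] ℝ} (hg : g.IsInvertible) (α : T →L[ℝ] ℝ) :
    g (musicalSharp g α) = α := by
  obtain ⟨e, rfl⟩ := hg
  simp [musicalSharp]

theorem cometric_endoJ {g : T →L[ℝ] T →L[ℝ] ℝ} (hg : g.IsInvertible)
    (hs : ∀ v w, g v w = g w v) (P : (T →L[ℝ] ℝ) →L[ℝ] T) (α η : T →L[ℝ] ℝ) :
    cometric g (endoJ g P α) η = bivector P α η := by
  rw [cometric, endoJ, musicalSharp_apply hg, hs, apply_musicalSharp hg, bivector]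

end Pointwise

/-! ## Contravariant calculus on an open subset of a vector space

All operations are differential operators; they only use the germs of the metric `g`, of the sharp
map `P` of the Poisson tensor and of the one-forms `V → V*` at the point of evaluation. -/

section VectorSpace

variable {V : Type*} [NormedAddCommGroup V] [NormedSpace ℝ V]

/-- The Lie derivative `L_X η` of a one-form: `(L_X η)(u) = (∂_X η)(u) + η(∂_u X)`. -/
def lieDeriv (X : V → V) (η : V → V →L[ℝ] ℝ) : V → V →L[ℝ] ℝ := fun y =>
  fderiv ℝ η y (X y) + (η y).comp (fderiv ℝ X y)

/-- The Lie bracket of one-forms,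
`[α, η]_Π = L_{♯α} η - L_{♯η} α - d(Π(α, η))`. -/
def bracket (P : V → (V →L[ℝ] ℝ) →L[ℝ] V) (α η : V → V →L[ℝ] ℝ) : V → V →L[ℝ] ℝ := fun y =>
  lieDeriv (fun z => P z (α z)) η y - lieDeriv (fun z => P z (η z)) α y
    - fderiv ℝ (fun z => bivector (P z) (α z) (η z)) y

/-- The contravariant Christoffel form `Γ(a, b)` at `y`: the value at `y` of the Levi-Civita
derivative of the constant form `b` along the constant form `a`.  For all `γ` it satisfies
`2 g̃(Γ(a,b), γ) = ♯a(g̃(b,γ)) + ♯b(g̃(a,γ)) - ♯γ(g̃(a,b)) + g̃(d(Π(a,b)),γ) - g̃(d(Π(a,γ)),b)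
- g̃(d(Π(b,γ)),a)`, the Koszul formula for constant one-forms. -/
def christoffel (g : V → V →L[ℝ] V →L[ℝ] ℝ) (P : V → (V →L[ℝ] ℝ) →L[ℝ] V) (y : V)
    (a b : V →L[ℝ] ℝ) : V →L[ℝ] ℝ :=
  (1 / 2 : ℝ) • g y
    (fderiv ℝ (fun z => musicalSharp (g z) b) y (P y a)
      + fderiv ℝ (fun z => musicalSharp (g z) a) y (P y b)
      + P y (fderiv ℝ (fun z => cometric (g z) a b) y)
      + musicalSharp (g y) (fderiv ℝ (fun z => bivector (P z) a b) y)
      - fderiv ℝ (fun z => P z a) y (musicalSharp (g y) b)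
      - fderiv ℝ (fun z => P z b) y (musicalSharp (g y) a))

/-- The contravariant Levi-Civita connection `𝒟_α η` of `(g̃, Π)`, which is torsion-free and
metric: see `leviCivita_torsionFree` and `leviCivita_metric`. -/
def leviCivita (g : V → V →L[ℝ] V →L[ℝ] ℝ) (P : V → (V →L[ℝ] ℝ) →L[ℝ] V)
    (α η : V → V →L[ℝ] ℝ) : V → V →L[ℝ] ℝ := fun y =>
  fderiv ℝ η y (P y (α y)) + christoffel g P y (α y) (η y)

/-- `ℛ(α, η)γ = 𝒟_α 𝒟_η γ - 𝒟_η 𝒟_α γ - 𝒟_{[α, η]_Π} γ`. -/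
def curvatureForm (g : V → V →L[ℝ] V →L[ℝ] ℝ) (P : V → (V →L[ℝ] ℝ) →L[ℝ] V)
    (α η γ : V → V →L[ℝ] ℝ) : V → V →L[ℝ] ℝ := fun y =>
  leviCivita g P α (leviCivita g P η γ) y - leviCivita g P η (leviCivita g P α γ) y
    - leviCivita g P (bracket P α η) γ y

/-- The curvature tensor on covectors at `y`, which are extended to constant one-forms. -/
def curvature (g : V → V →L[ℝ] V →L[ℝ] ℝ) (P : V → (V →L[ℝ] ℝ) →L[ℝ] V) (y : V)
    (a b c : V →L[ℝ] ℝ) : V →L[ℝ] ℝ :=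
  curvatureForm g P (fun _ => a) (fun _ => b) (fun _ => c) y

/-- `𝒦(a, b) = g̃(ℛ(a, b)b, a) / (g̃(a, a) g̃(b, b) - g̃(a, b)²)`. -/
def sectional (g : V → V →L[ℝ] V →L[ℝ] ℝ) (P : V → (V →L[ℝ] ℝ) →L[ℝ] V) (y : V)
    (a b : V →L[ℝ] ℝ) : ℝ :=
  cometric (g y) (curvature g P y a b b) a /
    (cometric (g y) a a * cometric (g y) b b - cometric (g y) a b ^ 2)

/-- The contravariant Hessian `H^u(a, b) = g̃(𝒟_a (J du), b)`. -/
def hessian (g : V → V →L[ℝ] V →L[ℝ] ℝ) (P : V → (V →L[ℝ] ℝ) →L[ℝ] V) (u : V → ℝ) (y : V)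
    (a b : V →L[ℝ] ℝ) : ℝ :=
  cometric (g y)
    (leviCivita g P (fun _ => a) (fun z => endoJ (g z) (P z) (fderiv ℝ u z)) y) b

end VectorSpace

section LeviCivita

variable {V : Type*} [NormedAddCommGroup V] [NormedSpace ℝ V]
  {g : V → V →L[ℝ] V →L[ℝ] ℝ} {P : V → (V →L[ℝ] ℝ) →L[ℝ] V} {y : V}

theorem cometric_eq {g : V →L[ℝ] V →L[ℝ] ℝ} (hs : ∀ v w, g v w = g w v) (hi : g.IsInvertible)
    (a b : V →L[ℝ] ℝ) : cometric g a b = b (musicalSharp g a) := by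
  rw [cometric, hs, apply_musicalSharp hi]

theorem cometric_comm {g : V →L[ℝ] V →L[ℝ] ℝ} (hs : ∀ v w, g v w = g w v)
    (a b : V →L[ℝ] ℝ) : cometric g a b = cometric g b a := hs _ _

theorem differentiableAt_musicalSharp [CompleteSpace V] (hg : DifferentiableAt ℝ g y) (hi : (g y).IsInvertible) :
    DifferentiableAt ℝ (fun z => musicalSharp (g z)) y := by
  obtain ⟨e, he⟩ := hi
  have h := (contDiffAt_map_inverse (𝕜 := ℝ) (n := 1) e).differentiableAt (by simp)
  rw [he] at h
  exact h.comp y hg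

theorem eventually_isInvertible [CompleteSpace V] (hg : DifferentiableAt ℝ g y) (hi : (g y).IsInvertible) :
    ∀ᶠ z in 𝓝 y, (g z).IsInvertible := by
  obtain ⟨e, he⟩ := hi
  have h := (ContinuousLinearEquiv.nhds e)
  rw [he] at h
  filter_upwards [hg.continuousAt h] with z hz
  obtain ⟨e', he'⟩ := hz
  exact ⟨e', he'⟩

theorem fderiv_cometric [CompleteSpace V] (hg : DifferentiableAt ℝ g y) (hs : ∀ z v w, g z v w = g z w v)
    (hi : (g y).IsInvertible) {η γ : V → V →L[ℝ] ℝ} (hη : DifferentiableAt ℝ η y)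
    (hγ : DifferentiableAt ℝ γ y) (u : V) :
    fderiv ℝ (fun z => cometric (g z) (η z) (γ z)) y u =
      γ y (fderiv ℝ (fun z => musicalSharp (g z)) y u (η y))
        + γ y (musicalSharp (g y) (fderiv ℝ η y u)) + fderiv ℝ γ y u (musicalSharp (g y) (η y)) := by
  have hG := differentiableAt_musicalSharp hg hi
  have h : (fun z => cometric (g z) (η z) (γ z)) =ᶠ[𝓝 y]
      fun z => γ z (musicalSharp (g z) (η z)) := by
    filter_upwards [eventually_isInvertible hg hi] with z hz
    exact cometric_eq (hs z) hz _ _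
  rw [h.fderiv_eq,
    (hγ.hasFDerivAt.clm_apply (hG.hasFDerivAt.clm_apply hη.hasFDerivAt)).fderiv]
  simp
  ring

theorem fderiv_bivector (hP : DifferentiableAt ℝ P y) {η γ : V → V →L[ℝ] ℝ}
    (hη : DifferentiableAt ℝ η y) (hγ : DifferentiableAt ℝ γ y) (u : V) :
    fderiv ℝ (fun z => bivector (P z) (η z) (γ z)) y u =
      γ y (fderiv ℝ P y u (η y)) + γ y (P y (fderiv ℝ η y u)) + fderiv ℝ γ y u (P y (η y)) := by
  have h : (fun z => bivector (P z) (η z) (γ z)) = fun z => γ z (P z (η z)) := rfl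
  rw [h, (hγ.hasFDerivAt.clm_apply (hP.hasFDerivAt.clm_apply hη.hasFDerivAt)).fderiv]
  simp
  ring

theorem fderiv_clm_const {W : Type*} [NormedAddCommGroup W] [NormedSpace ℝ W]
    {F : V → W →L[ℝ] V} (hF : DifferentiableAt ℝ F y) (a : W) (u : V) :
    fderiv ℝ (fun z => F z a) y u = fderiv ℝ F y u a := by
  rw [(hF.hasFDerivAt.clm_apply (hasFDerivAt_const a y)).fderiv]
  simp

theorem skew_fderiv (hP : DifferentiableAt ℝ P y) (hk : ∀ (z : V) (a b : V →L[ℝ] ℝ), b (P z a) = -a (P z b))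
    (a b : V →L[ℝ] ℝ) (u : V) : b (fderiv ℝ P y u a) = -a (fderiv ℝ P y u b) := by
  have h1 := fderiv_bivector hP (differentiableAt_const a) (differentiableAt_const b) u
  have h2 := fderiv_bivector hP (differentiableAt_const b) (differentiableAt_const a) u
  have h : (fun z => bivector (P z) a b) = fun z => -bivector (P z) b a := by
    funext z; exact hk z a b
  rw [h, fderiv_fun_neg] at h1
  simp at h1 h2
  linarith

/-- The Levi-Civita connection is torsion-free. -/
theorem leviCivita_torsionFree
    (hs : ∀ z v w, g z v w = g z w v) (hi : (g y).IsInvertible) (hP : DifferentiableAt ℝ P y)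
    (hk : ∀ (z : V) (a b : V →L[ℝ] ℝ), b (P z a) = -a (P z b)) {α η : V → V →L[ℝ] ℝ}
    (hα : DifferentiableAt ℝ α y) (hη : DifferentiableAt ℝ η y) :
    leviCivita g P α η y - leviCivita g P η α y = bracket P α η y := by
  have hc : (fun z => cometric (g z) (η y) (α y)) = fun z => cometric (g z) (α y) (η y) := by
    funext z; exact hs z _ _
  have hb : fderiv ℝ (fun z => bivector (P z) (η y) (α y)) y
      = -fderiv ℝ (fun z => bivector (P z) (α y) (η y)) y := by
    rw [← fderiv_fun_neg]
    congr 1; funext z; exact hk z _ _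
  have hΓ : christoffel g P y (α y) (η y) - christoffel g P y (η y) (α y)
      = fderiv ℝ (fun z => bivector (P z) (α y) (η y)) y := by
    rw [← apply_musicalSharp hi (fderiv ℝ (fun z => bivector (P z) (α y) (η y)) y),
      christoffel, christoffel, hc, hb, ← map_smul, ← map_smul, ← map_sub]
    congr 1
    simp only [map_neg]
    module
  ext u
  have hΓ' := congrArg (fun L => L u) hΓ
  simp only [fderiv_bivector hP (differentiableAt_const (α y)) (differentiableAt_const (η y)),
    sub_apply] at hΓ'
  have e1 : fderiv ℝ (fun z => P z (α z)) y u = fderiv ℝ P y u (α y) + P y (fderiv ℝ α y u) := by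
    rw [(hP.hasFDerivAt.clm_apply hα.hasFDerivAt).fderiv]; simp [add_comm]
  have e2 : fderiv ℝ (fun z => P z (η z)) y u = fderiv ℝ P y u (η y) + P y (fderiv ℝ η y u) := by
    rw [(hP.hasFDerivAt.clm_apply hη.hasFDerivAt).fderiv]; simp [add_comm]
  have k1 := skew_fderiv hP hk (α y) (η y) u
  have k2 := hk y (α y) (fderiv ℝ η y u)
  simp only [leviCivita, bracket, lieDeriv, sub_apply,
    add_apply, ContinuousLinearMap.comp_apply, e1, e2, map_add,
    fderiv_bivector hP hα hη]
  simp at hΓ'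
  linarith

/-- The Levi-Civita connection is metric: `♯α (g̃(η, γ)) = g̃(𝒟_α η, γ) + g̃(η, 𝒟_α γ)`. -/
theorem leviCivita_metric [CompleteSpace V] (hg : DifferentiableAt ℝ g y)
    (hs : ∀ z v w, g z v w = g z w v) (hi : (g y).IsInvertible) (hP : DifferentiableAt ℝ P y)
    (hk : ∀ (z : V) (a b : V →L[ℝ] ℝ), b (P z a) = -a (P z b)) (α : V → V →L[ℝ] ℝ) {η γ : V → V →L[ℝ] ℝ}
    (hη : DifferentiableAt ℝ η y) (hγ : DifferentiableAt ℝ γ y) :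
    fderiv ℝ (fun z => cometric (g z) (η z) (γ z)) y (P y (α y)) =
      cometric (g y) (leviCivita g P α η y) (γ y)
        + cometric (g y) (η y) (leviCivita g P α γ y) := by
  have hG := differentiableAt_musicalSharp hg hi
  have key : ∀ a b c : V →L[ℝ] ℝ, c (musicalSharp (g y) (christoffel g P y a b)) = (1 / 2 : ℝ) *
      (c (fderiv ℝ (fun z => musicalSharp (g z)) y (P y a) b)
        + c (fderiv ℝ (fun z => musicalSharp (g z)) y (P y b) a)
        - b (fderiv ℝ (fun z => musicalSharp (g z)) y (P y c) a)
        + b (fderiv ℝ P y (musicalSharp (g y) c) a)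
        - c (fderiv ℝ P y (musicalSharp (g y) b) a)
        - c (fderiv ℝ P y (musicalSharp (g y) a) b)) := by
    intro a b c
    have h1 := hk y (fderiv ℝ (fun z => cometric (g z) a b) y) c
    rw [fderiv_cometric hg hs hi (differentiableAt_const a) (differentiableAt_const b)] at h1
    have h2 : c (musicalSharp (g y) (fderiv ℝ (fun z => bivector (P z) a b) y))
        = fderiv ℝ (fun z => bivector (P z) a b) y (musicalSharp (g y) c) := by
      rw [← cometric_eq (hs y) hi, cometric_comm (hs y), cometric_eq (hs y) hi]
    rw [fderiv_bivector hP (differentiableAt_const a) (differentiableAt_const b)] at h2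
    rw [christoffel, ← map_smul, musicalSharp_apply hi]
    simp only [map_smul, map_sub, map_add, smul_eq_mul, h1, h2, fderiv_clm_const hG,
      fderiv_clm_const hP]
    simp
    ring
  have sym : ∀ (b c : V →L[ℝ] ℝ) (u : V), c (fderiv ℝ (fun z => musicalSharp (g z)) y u b)
      = b (fderiv ℝ (fun z => musicalSharp (g z)) y u c) := by
    intro b c u
    have h1 := fderiv_cometric hg hs hi (differentiableAt_const b) (differentiableAt_const c) u
    have h2 := fderiv_cometric hg hs hi (differentiableAt_const c) (differentiableAt_const b) u
    have h : (fun z => cometric (g z) b c) = fun z => cometric (g z) c b := by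
      funext z; exact hs z _ _
    rw [h] at h1
    simp at h1 h2
    linarith
  have e1 := key (α y) (η y) (γ y)
  have e2 := key (α y) (γ y) (η y)
  have s1 := sym (η y) (γ y) (P y (α y))
  have k1 := skew_fderiv hP hk (η y) (γ y) (musicalSharp (g y) (α y))
  have c1 : fderiv ℝ γ y (P y (α y)) (musicalSharp (g y) (η y))
      = η y (musicalSharp (g y) (fderiv ℝ γ y (P y (α y)))) := by
    rw [← cometric_eq (hs y) hi, cometric_comm (hs y), cometric_eq (hs y) hi]
  rw [fderiv_cometric hg hs hi hη hγ, cometric_comm (hs y) (η y), cometric_eq (hs y) hi,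
    cometric_eq (hs y) hi, leviCivita, leviCivita]
  simp only [map_add, e1, e2, c1]
  linarith

end LeviCivita

/-! ## Metrics, Poisson tensors and curvature on manifolds -/

section Manifolds

variable {E : Type*} [NormedAddCommGroup E] [NormedSpace ℝ E]
  {H : Type*} [TopologicalSpace H] (I : ModelWithCorners ℝ E H)
  {M : Type*} [TopologicalSpace M] [ChartedSpace H M]

/-- The cotangent space of `M` at `x`. -/
abbrev Cotangent (x : M) : Type _ := TangentSpace I x →L[ℝ] ℝ

/-- A field of bilinear forms on the tangent spaces of `M`. -/
abbrev MetricField (M : Type*) [TopologicalSpace M] [ChartedSpace H M] : Type _ :=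
  ∀ x : M, TangentSpace I x →L[ℝ] TangentSpace I x →L[ℝ] ℝ

/-- A field of maps `T*M → TM`, used as the sharp map of a bivector field. -/
abbrev SharpField (M : Type*) [TopologicalSpace M] [ChartedSpace H M] : Type _ :=
  ∀ x : M, Cotangent I x →L[ℝ] TangentSpace I x

variable {I}

/-- The coordinate expression of a bilinear form field in the preferred chart at `p`. -/
def readMetric (g : MetricField I M) (p : M) : E → E →L[ℝ] E →L[ℝ] ℝ := fun y =>
  let A : E →L[ℝ] TangentSpace I ((extChartAt I p).symm y) :=
    mfderiv 𝓘(ℝ, E) I (extChartAt I p).symm y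
  (ContinuousLinearMap.precomp ℝ A).comp ((g ((extChartAt I p).symm y)).comp A)

/-- The coordinate expression of a sharp map in the preferred chart at `p`. -/
def readSharp (P : SharpField I M) (p : M) : E → (E →L[ℝ] ℝ) →L[ℝ] E := fun y =>
  let B : TangentSpace I ((extChartAt I p).symm y) →L[ℝ] E :=
    mfderiv I 𝓘(ℝ, E) (extChartAt I p) ((extChartAt I p).symm y)
  B.comp ((P ((extChartAt I p).symm y)).comp (ContinuousLinearMap.precomp ℝ B))

/-- The coordinate expression of a covector at `p` in the preferred chart at `p`. -/
def readCovector (p : M) (a : Cotangent I p) : E →L[ℝ] ℝ :=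
  let A : E →L[ℝ] TangentSpace I p := mfderiv 𝓘(ℝ, E) I (extChartAt I p).symm (extChartAt I p p)
  a.comp A

variable (I) in
/-- The differential `du` at `x`. -/
def differential (u : M → ℝ) (x : M) : Cotangent I x := mfderiv I 𝓘(ℝ, ℝ) u x

/-- `g` is a smooth pseudo-Riemannian metric of index `q`. -/
structure IsPseudoRiemannianMetric (g : MetricField I M) (q : ℕ) : Prop where
  smooth : ∀ p : M, ContDiffOn ℝ ∞ (readMetric g p) (extChartAt I p).target
  symm : ∀ (x : M) (v w : TangentSpace I x), g x v w = g x w v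
  nondegenerate : ∀ (x : M) (v : TangentSpace I x), (∀ w, g x v w = 0) → v = 0
  index_le : q ≤ Module.finrank ℝ E
  index : ∀ x : M, ∃ b : Module.Basis (Fin (Module.finrank ℝ E)) ℝ (TangentSpace I x), ∀ i j,
    g x (b i) (b j) = if i = j then (if (i : ℕ) < q then -1 else 1) else 0

/-- `g` is a smooth Riemannian metric. -/
structure IsRiemannianMetric (g : MetricField I M) : Prop where
  smooth : ∀ p : M, ContDiffOn ℝ ∞ (readMetric g p) (extChartAt I p).target
  symm : ∀ (x : M) (v w : TangentSpace I x), g x v w = g x w v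
  pos : ∀ (x : M) (v : TangentSpace I x), v ≠ 0 → 0 < g x v v

/-- The bracket `{u, v} = Π(du, dv)`. -/
def poissonBracket (P : SharpField I M) (u v : M → ℝ) : M → ℝ := fun x =>
  bivector (P x) (differential I u x) (differential I v x)

/-- `P` is the sharp map of a smooth Poisson tensor: a smooth bivector field (smooth and
skew-symmetric) whose bracket satisfies the Jacobi identity. -/
structure IsPoisson (P : SharpField I M) : Prop where
  smooth : ∀ p : M, ContDiffOn ℝ ∞ (readSharp P p) (extChartAt I p).target
  skew : ∀ (x : M) (a b : Cotangent I x), bivector (P x) a b = -bivector (P x) b a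
  jacobi : ∀ (x : M) (u v w : M → ℝ), ContMDiffAt I 𝓘(ℝ, ℝ) ∞ u x →
    ContMDiffAt I 𝓘(ℝ, ℝ) ∞ v x → ContMDiffAt I 𝓘(ℝ, ℝ) ∞ w x →
    poissonBracket P (poissonBracket P u v) w x + poissonBracket P (poissonBracket P v w) u x
      + poissonBracket P (poissonBracket P w u) v x = 0

/-- The sectional curvature `𝒦_p(a, b)` of `(M, g̃, Π)` at `p`. -/
def sectionalCurvature (g : MetricField I M) (P : SharpField I M) (p : M)
    (a b : Cotangent I p) : ℝ :=
  sectional (readMetric g p) (readSharp P p) (extChartAt I p p) (readCovector p a)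
    (readCovector p b)

/-- The contravariant Hessian `H^u(a, b) = g̃(𝒟_a (J du), b)` at `p`. -/
def contravariantHessian (g : MetricField I M) (P : SharpField I M) (u : M → ℝ) (p : M)
    (a b : Cotangent I p) : ℝ :=
  hessian (readMetric g p) (readSharp P p) (fun y => u ((extChartAt I p).symm y))
    (extChartAt I p p) (readCovector p a) (readCovector p b)

/-- `e` is a `g̃`-orthonormal basis of `T*_pM`, the first `q` members of which are timelike. -/
def IsOrthonormalCoframe (g : MetricField I M) (p : M) (q : ℕ)
    (e : Fin (Module.finrank ℝ E) → Cotangent I p) : Prop :=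
  ∀ i j, cometric (g p) (e i) (e j) = if i = j then (if (i : ℕ) < q then -1 else 1) else 0

end Manifolds

/-! ## The contravariant warped product -/

section Warped

variable {E₁ : Type*} [NormedAddCommGroup E₁] [NormedSpace ℝ E₁]
  {H₁ : Type*} [TopologicalSpace H₁] {I₁ : ModelWithCorners ℝ E₁ H₁}
  {M₁ : Type*} [TopologicalSpace M₁] [ChartedSpace H₁ M₁]
  {E₂ : Type*} [NormedAddCommGroup E₂] [NormedSpace ℝ E₂]
  {H₂ : Type*} [TopologicalSpace H₂] {I₂ : ModelWithCorners ℝ E₂ H₂}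
  {M₂ : Type*} [TopologicalSpace M₂] [ChartedSpace H₂ M₂]

/-- The differential of the projection `π₁ : M₁ × M₂ → M₁`. -/
def dFst (x : M₁ × M₂) : TangentSpace (I₁.prod I₂) x →L[ℝ] TangentSpace I₁ x.1 :=
  mfderiv (I₁.prod I₂) I₁ Prod.fst x

/-- The differential of the projection `π₂ : M₁ × M₂ → M₂`. -/
def dSnd (x : M₁ × M₂) : TangentSpace (I₁.prod I₂) x →L[ℝ] TangentSpace I₂ x.2 :=
  mfderiv (I₁.prod I₂) I₂ Prod.snd x

/-- The horizontal lift of tangent vectors of `M₁`. -/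
def hLift (x : M₁ × M₂) : TangentSpace I₁ x.1 →L[ℝ] TangentSpace (I₁.prod I₂) x :=
  mfderiv I₁ (I₁.prod I₂) (fun z => (z, x.2)) x.1

/-- The vertical lift of tangent vectors of `M₂`. -/
def vLift (x : M₁ × M₂) : TangentSpace I₂ x.2 →L[ℝ] TangentSpace (I₁.prod I₂) x :=
  mfderiv I₂ (I₁.prod I₂) (fun z => (x.1, z)) x.2

/-- The horizontal lift `a^h = π₁^* a` of a covector of `M₁`. -/
def hCovector (x : M₁ × M₂) (a : Cotangent I₁ x.1) : Cotangent (I₁.prod I₂) x := a.comp (dFst x)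

/-- The vertical lift `b^v = π₂^* b` of a covector of `M₂`. -/
def vCovector (x : M₁ × M₂) (b : Cotangent I₂ x.2) : Cotangent (I₁.prod I₂) x := b.comp (dSnd x)

/-- The warped metric `π₁^* g₁ + (f ∘ π₁)² π₂^* g₂`. -/
def warpedMetric (g₁ : MetricField I₁ M₁) (f : M₁ → ℝ) (g₂ : MetricField I₂ M₂) :
    MetricField (I₁.prod I₂) (M₁ × M₂) := fun x =>
  (ContinuousLinearMap.precomp ℝ (dFst x)).comp ((g₁ x.1).comp (dFst x))
    + f x.1 ^ 2 • (ContinuousLinearMap.precomp ℝ (dSnd x)).comp ((g₂ x.2).comp (dSnd x))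

/-- The sharp map of the bivector field `Π^ν = Π₁ + ν Π₂` on `M₁ × M₂`. -/
def warpedSharp (P₁ : SharpField I₁ M₁) (ν : M₁ → ℝ) (P₂ : SharpField I₂ M₂) :
    SharpField (I₁.prod I₂) (M₁ × M₂) := fun x =>
  (hLift x).comp ((P₁ x.1).comp (ContinuousLinearMap.precomp ℝ (hLift x)))
    + ν x.1 • (vLift x).comp ((P₂ x.2).comp (ContinuousLinearMap.precomp ℝ (vLift x)))

/-- The qualar curvature `𝒬(p)` of the contravariant warped product
`(M₁ ×_f M₂, Π₁ + ν Π₂, g̃^f)`, computed in the basis `dx_i^h`, `f^h dy_j^v` made of orthonormal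
bases `dx = e₁`, `dy = e₂` whose first `q₁`, respectively `q₂`, members are timelike. -/
def qualarCurvature (g₁ : MetricField I₁ M₁) (P₁ : SharpField I₁ M₁) (f ν : M₁ → ℝ)
    (g₂ : MetricField I₂ M₂) (P₂ : SharpField I₂ M₂) (p : M₁ × M₂) (q₁ q₂ : ℕ)
    (e₁ : Fin (Module.finrank ℝ E₁) → Cotangent I₁ p.1)
    (e₂ : Fin (Module.finrank ℝ E₂) → Cotangent I₂ p.2) : ℝ :=
  let K := sectionalCurvature (warpedMetric g₁ f g₂) (warpedSharp P₁ ν P₂) p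
  let X : Fin (Module.finrank ℝ E₁) → Cotangent (I₁.prod I₂) p := fun i => hCovector p (e₁ i)
  let Y : Fin (Module.finrank ℝ E₂) → Cotangent (I₁.prod I₂) p :=
    fun j => f p.1 • vCovector p (e₂ j)
  2 * ∑ i : Fin (Module.finrank ℝ E₁) with i.val < q₁,
      ∑ s : Fin (Module.finrank ℝ E₁) with q₁ ≤ s.val, K (X i) (X s)
    + 2 * ∑ i : Fin (Module.finrank ℝ E₁) with i.val < q₁,
      ∑ s : Fin (Module.finrank ℝ E₂) with q₂ ≤ s.val, K (X i) (Y s)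
    + 2 * ∑ i : Fin (Module.finrank ℝ E₂) with i.val < q₂,
      ∑ s : Fin (Module.finrank ℝ E₁) with q₁ ≤ s.val, K (Y i) (X s)
    + 2 * ∑ i : Fin (Module.finrank ℝ E₂) with i.val < q₂,
      ∑ s : Fin (Module.finrank ℝ E₂) with q₂ ≤ s.val, K (Y i) (Y s)

end Warped

end ContravariantGeometry

end

/-! Since `M₂` is Riemannian, no covector of `M₂` is timelike. The double sums of the qualar
curvature over timelike vertical covectors are therefore empty, and only the planes `(X_i, X_s)` and
`(X_i, Y_s)` with `X_i` timelike remain. Both kinds of curvature are computed in a product chart,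
where the warped metric and bivector become `g₁ + f² g₂` and `P₁ + c P₂` on a product of vector
spaces.

The computation rests on `IsWarpedAt.christoffel_eq`. For constant forms `α = (α₁, α₂)`, `β = (β₁,
β₂)` the Christoffel form has first component `Γ₁(α₁, β₁) - f⁻³ g̃₂(α₂, β₂) J₁df` and second
component `c Γ₂(α₂, β₂) - f⁻¹ df(♯₁α₁) β₂ - f⁻¹ df(♯₁β₁) α₂`. As `ν₁` is the constant `c`, no term
in `dν₁` occurs, and `c` enters only the vertical component.

On horizontal forms this is `Γ₁`, so `sectional_fst` gives the curvature of the base. For horizontal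
`a` and vertical `b`, the horizontal part of `ℛ(a, b)b` is `-f⁻³ g̃₂(b, b) 𝒟_a(J₁df) + 2 f⁻⁴ df(♯₁a)
g̃₂(b, b) J₁df` (`curvature_fst_snd_inl`). Now take `g̃₁(a, a) = -1` and `g̃₂(b, b) = f²`, pair with
`a`, use `df(♯₁a) = -g̃₁(J₁df, a)` and divide by the Gram determinant `-1`. The result, `H^f(a, a)/f
+ 2 g̃₁(J₁df, a)²/f²`, contains neither `b`, `g₂`, `P₂` nor `c`, so summing over the fibre indices
multiplies it by `k₂`.

The chart lemmas, ending in `sectionalCurvature_warped`, `sectionalCurvature_horizontal` and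
`sectionalCurvature_mixed`, carry these identities to the manifolds. -/

noncomputable section

namespace ContravariantGeometry

/-! ### Warped products of vector spaces and their Christoffel form. -/

section LocalWarped

variable {V₁ : Type*} [NormedAddCommGroup V₁] [NormedSpace ℝ V₁]
  {V₂ : Type*} [NormedAddCommGroup V₂] [NormedSpace ℝ V₂]

open ContinuousLinearMap (inl inr precomp)

/-- The warped metric `g₁ + f² g₂` on a product of vector spaces. -/
def prodMetric (g₁ : V₁ → V₁ →L[ℝ] V₁ →L[ℝ] ℝ) (f : V₁ → ℝ) (g₂ : V₂ → V₂ →L[ℝ] V₂ →L[ℝ] ℝ) :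
    V₁ × V₂ → V₁ × V₂ →L[ℝ] V₁ × V₂ →L[ℝ] ℝ := fun z =>
  (precomp ℝ (ContinuousLinearMap.fst ℝ V₁ V₂)).comp ((g₁ z.1).comp (ContinuousLinearMap.fst ℝ V₁ V₂))
    + f z.1 ^ 2 • (precomp ℝ (ContinuousLinearMap.snd ℝ V₁ V₂)).comp
      ((g₂ z.2).comp (ContinuousLinearMap.snd ℝ V₁ V₂))

/-- The sharp map of `Π₁ + c Π₂` on a product of vector spaces. -/
def prodSharp (P₁ : V₁ → (V₁ →L[ℝ] ℝ) →L[ℝ] V₁) (c : ℝ) (P₂ : V₂ → (V₂ →L[ℝ] ℝ) →L[ℝ] V₂) :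
    V₁ × V₂ → (V₁ × V₂ →L[ℝ] ℝ) →L[ℝ] V₁ × V₂ := fun z =>
  (inl ℝ V₁ V₂).comp ((P₁ z.1).comp (precomp ℝ (inl ℝ V₁ V₂)))
    + c • (inr ℝ V₁ V₂).comp ((P₂ z.2).comp (precomp ℝ (inr ℝ V₁ V₂)))

/-- A metric and the sharp map of a bivector which are smooth near `y`, the metric being
nondegenerate at `y`. -/
structure IsSmoothPair {V : Type*} [NormedAddCommGroup V] [NormedSpace ℝ V]
    (g : V → V →L[ℝ] V →L[ℝ] ℝ) (P : V → (V →L[ℝ] ℝ) →L[ℝ] V) (y : V) : Prop where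
  eventually_metric : ∀ᶠ z in 𝓝 y, ContDiffAt ℝ ∞ g z
  invertible : (g y).IsInvertible
  eventually_sharp : ∀ᶠ z in 𝓝 y, ContDiffAt ℝ ∞ P z

namespace IsSmoothPair

variable {V : Type*} [NormedAddCommGroup V] [NormedSpace ℝ V]
  {g : V → V →L[ℝ] V →L[ℝ] ℝ} {P : V → (V →L[ℝ] ℝ) →L[ℝ] V} {y : V}

theorem metric (h : IsSmoothPair g P y) : ContDiffAt ℝ ∞ g y := h.eventually_metric.self_of_nhds

theorem sharp (h : IsSmoothPair g P y) : ContDiffAt ℝ ∞ P y := h.eventually_sharp.self_of_nhds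

theorem sharp_const (h : IsSmoothPair g P y) (a : V →L[ℝ] ℝ) :
    ContDiffAt ℝ ∞ (fun z => P z a) y :=
  h.sharp.clm_apply contDiffAt_const

theorem bivector (h : IsSmoothPair g P y) (a b : V →L[ℝ] ℝ) :
    ContDiffAt ℝ ∞ (fun z => bivector (P z) a b) y :=
  contDiffAt_const.clm_apply (h.sharp_const a)

theorem endoJ (h : IsSmoothPair g P y) {u : V → ℝ} (hu : ContDiffAt ℝ ∞ u y) :
    ContDiffAt ℝ ∞ (fun z => endoJ (g z) (P z) (fderiv ℝ u z)) y :=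
  h.metric.clm_apply (h.sharp.clm_apply (hu.fderiv_right (by simp)))

variable [CompleteSpace V]

theorem musicalSharp (h : IsSmoothPair g P y) :
    ContDiffAt ℝ ∞ (fun z => musicalSharp (g z)) y := by
  obtain ⟨e, he⟩ := h.invertible
  have h' := contDiffAt_map_inverse (𝕜 := ℝ) (n := ∞) e
  rw [he] at h'
  exact h'.comp y h.metric

theorem eventually (h : IsSmoothPair g P y) : ∀ᶠ z in 𝓝 y, IsSmoothPair g P z := by
  filter_upwards [h.eventually_metric.eventually_nhds, h.eventually_sharp.eventually_nhds,
    eventually_isInvertible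
      (h.metric.differentiableAt (by simp)) h.invertible]
    with z a b c using ⟨a, c, b⟩

theorem musicalSharp_const (h : IsSmoothPair g P y) (a : V →L[ℝ] ℝ) :
    ContDiffAt ℝ ∞ (fun z => ContravariantGeometry.musicalSharp (g z) a) y :=
  h.musicalSharp.clm_apply contDiffAt_const

theorem cometric (h : IsSmoothPair g P y) (a b : V →L[ℝ] ℝ) :
    ContDiffAt ℝ ∞ (fun z => cometric (g z) a b) y :=
  (h.metric.clm_apply (h.musicalSharp_const a)).clm_apply (h.musicalSharp_const b)

/-- The curvature differentiates `Γ` once more, so `Γ` of constant forms must itself be known to be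
smooth. -/
theorem christoffel (h : IsSmoothPair g P y) (a b : V →L[ℝ] ℝ) :
    ContDiffAt ℝ ∞ (fun z => christoffel g P z a b) y := by
  have hG (a b) : ContDiffAt ℝ ∞
      (fun z => fderiv ℝ (fun w => ContravariantGeometry.musicalSharp (g w) b) z (P z a)) y :=
    ((h.musicalSharp_const b).fderiv_right (by simp)).clm_apply (h.sharp_const a)
  have hP (a b) : ContDiffAt ℝ ∞
      (fun z => fderiv ℝ (fun w => P w a) z (ContravariantGeometry.musicalSharp (g z) b)) y :=
    ((h.sharp_const a).fderiv_right (by simp)).clm_apply (h.musicalSharp_const b)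
  have hc : ContDiffAt ℝ ∞
      (fun z => P z (fderiv ℝ (fun w => ContravariantGeometry.cometric (g w) a b) z)) y :=
    h.sharp.clm_apply ((h.cometric a b).fderiv_right (by simp))
  have hb : ContDiffAt ℝ ∞ (fun z => ContravariantGeometry.musicalSharp (g z)
      (fderiv ℝ (fun w => ContravariantGeometry.bivector (P w) a b) z)) y :=
    h.musicalSharp.clm_apply ((h.bivector a b).fderiv_right (by simp))
  exact (h.metric.clm_apply (((((hG a b).add (hG b a)).add hc).add hb).sub (hP a b)
    |>.sub (hP b a))).const_smul (1 / 2 : ℝ)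

end IsSmoothPair

/-! ### Dependence on germs only. -/

section Germs

variable {V : Type*} [NormedAddCommGroup V] [NormedSpace ℝ V]
  {g g' : V → V →L[ℝ] V →L[ℝ] ℝ} {P P' : V → (V →L[ℝ] ℝ) →L[ℝ] V} {y : V}

theorem christoffel_congr (hg : g =ᶠ[𝓝 y] g') (hP : P =ᶠ[𝓝 y] P') (a b : V →L[ℝ] ℝ) :
    christoffel g P y a b = christoffel g' P' y a b := by
  have e1 : ∀ c, fderiv ℝ (fun z => musicalSharp (g z) c) y
      = fderiv ℝ (fun z => musicalSharp (g' z) c) y := fun c =>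
    (hg.fun_comp fun G => musicalSharp G c).fderiv_eq
  have e2 : ∀ c, fderiv ℝ (fun z => P z c) y = fderiv ℝ (fun z => P' z c) y := fun c =>
    (hP.fun_comp fun G => G c).fderiv_eq
  have e3 : fderiv ℝ (fun z => cometric (g z) a b) y = fderiv ℝ (fun z => cometric (g' z) a b) y :=
    (hg.fun_comp fun G => cometric G a b).fderiv_eq
  have e4 : fderiv ℝ (fun z => bivector (P z) a b) y = fderiv ℝ (fun z => bivector (P' z) a b) y :=
    (hP.fun_comp fun G => bivector G a b).fderiv_eq
  simp only [christoffel, e1, e2, e3, e4, hg.eq_of_nhds, hP.eq_of_nhds]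

theorem bracket_congr (hP : P =ᶠ[𝓝 y] P') (a b : V → V →L[ℝ] ℝ) :
    bracket P a b y = bracket P' a b y := by
  have e1 : ∀ c : V → V →L[ℝ] ℝ, fderiv ℝ (fun z => P z (c z)) y = fderiv ℝ (fun z => P' z (c z)) y :=
    fun c => Filter.EventuallyEq.fderiv_eq (hP.mono fun z hz => congrArg (fun G => G (c z)) hz)
  have e4 : fderiv ℝ (fun z => bivector (P z) (a z) (b z)) y
      = fderiv ℝ (fun z => bivector (P' z) (a z) (b z)) y :=
    Filter.EventuallyEq.fderiv_eq
      (hP.mono fun z hz => congrArg (fun G => bivector G (a z) (b z)) hz)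
  simp only [bracket, lieDeriv, e1, e4, hP.eq_of_nhds]

theorem leviCivita_congr (hg : g =ᶠ[𝓝 y] g') (hP : P =ᶠ[𝓝 y] P') {α α' η η' : V → V →L[ℝ] ℝ}
    (hα : α y = α' y) (hη : η =ᶠ[𝓝 y] η') :
    leviCivita g P α η y = leviCivita g' P' α' η' y := by
  simp only [leviCivita, hη.fderiv_eq, hP.eq_of_nhds, hα, hη.eq_of_nhds,
    christoffel_congr hg hP]

/-- The inner connection is differentiated again. It must therefore agree on a neighbourhood, which
holds because equal germs at `y` are equal germs at all nearby points. -/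
theorem curvature_congr (hg : g =ᶠ[𝓝 y] g') (hP : P =ᶠ[𝓝 y] P') (a b c : V →L[ℝ] ℝ) :
    curvature g P y a b c = curvature g' P' y a b c := by
  have h : ∀ a : V →L[ℝ] ℝ, leviCivita g P (fun _ => a) (fun _ => c)
      =ᶠ[𝓝 y] leviCivita g' P' (fun _ => a) (fun _ => c) := fun a => by
    filter_upwards [hg.eventuallyEq_nhds, hP.eventuallyEq_nhds] with z h1 h2
    exact leviCivita_congr h1 h2 rfl .rfl
  rw [curvature, curvature, curvatureForm, curvatureForm, leviCivita_congr hg hP rfl (h b),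
    leviCivita_congr hg hP rfl (h a), leviCivita_congr hg hP (bracket_congr hP _ _) .rfl]

theorem sectional_congr (hg : g =ᶠ[𝓝 y] g') (hP : P =ᶠ[𝓝 y] P') (a b : V →L[ℝ] ℝ) :
    sectional g P y a b = sectional g' P' y a b := by
  rw [sectional, sectional, curvature_congr hg hP, hg.eq_of_nhds]

/-- The curvature of constant one-forms in terms of the contravariant Christoffel form. -/
theorem curvature_eq (a b c : V →L[ℝ] ℝ) :
    curvature g P y a b c =
      (fderiv ℝ (fun z => christoffel g P z b c) y (P y a)
        + christoffel g P y a (christoffel g P y b c))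
      - (fderiv ℝ (fun z => christoffel g P z a c) y (P y b)
        + christoffel g P y b (christoffel g P y a c))
      - christoffel g P y (bracket P (fun _ => a) (fun _ => b) y) c := by
  have h : ∀ b : V →L[ℝ] ℝ, leviCivita g P (fun _ => b) (fun _ => c)
      = fun z => christoffel g P z b c := fun b => by
    funext z; simp [leviCivita]
  rw [curvature, curvatureForm, h, h]
  simp [leviCivita]

end Germs

variable {g₁ : V₁ → V₁ →L[ℝ] V₁ →L[ℝ] ℝ} {P₁ : V₁ → (V₁ →L[ℝ] ℝ) →L[ℝ] V₁} {f : V₁ → ℝ} {c : ℝ}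
  {g₂ : V₂ → V₂ →L[ℝ] V₂ →L[ℝ] ℝ} {P₂ : V₂ → (V₂ →L[ℝ] ℝ) →L[ℝ] V₂} {z : V₁ × V₂}

@[simp] theorem prodMetric_apply (v w : V₁ × V₂) :
    prodMetric g₁ f g₂ z v w = g₁ z.1 v.1 w.1 + f z.1 ^ 2 * g₂ z.2 v.2 w.2 := by
  simp [prodMetric]

theorem prodSharp_apply (α : V₁ × V₂ →L[ℝ] ℝ) :
    prodSharp P₁ c P₂ z α
      = (P₁ z.1 (α.comp (inl ℝ V₁ V₂)), c • P₂ z.2 (α.comp (inr ℝ V₁ V₂))) := by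
  simp [prodSharp]

theorem prod_comp_eq (α : V₁ × V₂ →L[ℝ] ℝ) (v : V₁ × V₂) :
    α v = α.comp (inl ℝ V₁ V₂) v.1 + α.comp (inr ℝ V₁ V₂) v.2 := by
  rw [ContinuousLinearMap.comp_apply, ContinuousLinearMap.comp_apply, ← map_add]; simp

/-- The metric is block diagonal with blocks `g₁` and `f² g₂`, so its inverse `N` is block diagonal
with the inverse blocks. This is where the factor `f⁻²` of the cometric comes from. -/
theorem musicalSharp_prodMetric (h₁ : (g₁ z.1).IsInvertible) (h₂ : (g₂ z.2).IsInvertible)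
    (hf : f z.1 ≠ 0) (α : V₁ × V₂ →L[ℝ] ℝ) :
    musicalSharp (prodMetric g₁ f g₂ z) α = (musicalSharp (g₁ z.1) (α.comp (inl ℝ V₁ V₂)),
      (f z.1 ^ 2)⁻¹ • musicalSharp (g₂ z.2) (α.comp (inr ℝ V₁ V₂))) := by
  let N : (V₁ × V₂ →L[ℝ] ℝ) →L[ℝ] V₁ × V₂ :=
    (inl ℝ V₁ V₂).comp ((musicalSharp (g₁ z.1)).comp (precomp ℝ (inl ℝ V₁ V₂)))
    + (f z.1 ^ 2)⁻¹ • (inr ℝ V₁ V₂).comp ((musicalSharp (g₂ z.2)).comp (precomp ℝ (inr ℝ V₁ V₂)))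
  have hN : ∀ α, N α = (musicalSharp (g₁ z.1) (α.comp (inl ℝ V₁ V₂)),
      (f z.1 ^ 2)⁻¹ • musicalSharp (g₂ z.2) (α.comp (inr ℝ V₁ V₂))) := fun α => by simp [N]
  have hf2 : f z.1 ^ 2 ≠ 0 := pow_ne_zero _ hf
  -- `ContinuousLinearMap.inverse` is `0` on maps that are not invertible, so `N` has to be verified
  -- as an inverse on both sides.
  have e1 : (prodMetric g₁ f g₂ z).comp N = .id ℝ _ := by
    refine ContinuousLinearMap.ext fun α => ContinuousLinearMap.ext fun v => ?_
    rw [ContinuousLinearMap.comp_apply, hN, prodMetric_apply]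
    simp only [map_smul, smul_apply, smul_eq_mul, apply_musicalSharp h₁,
      apply_musicalSharp h₂, ContinuousLinearMap.id_apply, mul_inv_cancel_left₀ hf2]
    exact (prod_comp_eq α v).symm
  have e2 : N.comp (prodMetric g₁ f g₂ z) = .id ℝ _ := by
    refine ContinuousLinearMap.ext fun v => ?_
    have i1 : (prodMetric g₁ f g₂ z v).comp (inl ℝ V₁ V₂) = g₁ z.1 v.1 := by ext; simp
    have i2 : (prodMetric g₁ f g₂ z v).comp (inr ℝ V₁ V₂) = f z.1 ^ 2 • g₂ z.2 v.2 := by ext; simp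
    rw [ContinuousLinearMap.comp_apply, hN, i1, i2, map_smul, musicalSharp_apply h₁,
      musicalSharp_apply h₂, inv_smul_smul₀ hf2]
    rfl
  rw [← hN, musicalSharp, ContinuousLinearMap.inverse_eq e1 e2]

theorem cometric_prodMetric (h₁ : (g₁ z.1).IsInvertible) (h₂ : (g₂ z.2).IsInvertible)
    (hf : f z.1 ≠ 0) (α β : V₁ × V₂ →L[ℝ] ℝ) :
    cometric (prodMetric g₁ f g₂ z) α β
      = cometric (g₁ z.1) (α.comp (inl ℝ V₁ V₂)) (β.comp (inl ℝ V₁ V₂))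
        + (f z.1 ^ 2)⁻¹ * cometric (g₂ z.2) (α.comp (inr ℝ V₁ V₂)) (β.comp (inr ℝ V₁ V₂)) := by
  rw [cometric, musicalSharp_prodMetric h₁ h₂ hf, musicalSharp_prodMetric h₁ h₂ hf,
    prodMetric_apply, cometric, cometric]
  simp only [map_smul, smul_apply, smul_eq_mul]
  field_simp

theorem bivector_prodSharp (α β : V₁ × V₂ →L[ℝ] ℝ) :
    bivector (prodSharp P₁ c P₂ z) α β
      = bivector (P₁ z.1) (α.comp (inl ℝ V₁ V₂)) (β.comp (inl ℝ V₁ V₂))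
        + c * bivector (P₂ z.2) (α.comp (inr ℝ V₁ V₂)) (β.comp (inr ℝ V₁ V₂)) := by
  rw [bivector, prodSharp_apply, prod_comp_eq]
  simp [bivector]

section Projections

variable {W : Type*} [NormedAddCommGroup W] [NormedSpace ℝ W]

theorem hasFDerivAt_comp_fst {F : V₁ → W} (hF : DifferentiableAt ℝ F z.1) :
    HasFDerivAt (fun w : V₁ × V₂ => F w.1)
      ((fderiv ℝ F z.1).comp (ContinuousLinearMap.fst ℝ V₁ V₂)) z :=
  hF.hasFDerivAt.comp z hasFDerivAt_fst

theorem hasFDerivAt_comp_snd {F : V₂ → W} (hF : DifferentiableAt ℝ F z.2) :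
    HasFDerivAt (fun w : V₁ × V₂ => F w.2)
      ((fderiv ℝ F z.2).comp (ContinuousLinearMap.snd ℝ V₁ V₂)) z :=
  hF.hasFDerivAt.comp z hasFDerivAt_snd

end Projections

/-- The local data of a contravariant warped product, smooth near `z`. -/
structure IsWarpedAt (g₁ : V₁ → V₁ →L[ℝ] V₁ →L[ℝ] ℝ) (P₁ : V₁ → (V₁ →L[ℝ] ℝ) →L[ℝ] V₁)
    (f : V₁ → ℝ) (g₂ : V₂ → V₂ →L[ℝ] V₂ →L[ℝ] ℝ) (P₂ : V₂ → (V₂ →L[ℝ] ℝ) →L[ℝ] V₂)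
    (z : V₁ × V₂) : Prop where
  left : IsSmoothPair g₁ P₁ z.1
  right : IsSmoothPair g₂ P₂ z.2
  eventually_smooth : ∀ᶠ w in 𝓝 z.1, ContDiffAt ℝ ∞ f w
  ne_zero : f z.1 ≠ 0

namespace IsWarpedAt

theorem smooth (h : IsWarpedAt g₁ P₁ f g₂ P₂ z) : ContDiffAt ℝ ∞ f z.1 :=
  h.eventually_smooth.self_of_nhds

theorem fderiv_bivector (h : IsWarpedAt g₁ P₁ f g₂ P₂ z) (c : ℝ) (α β : V₁ × V₂ →L[ℝ] ℝ) :
    fderiv ℝ (fun w => bivector (prodSharp P₁ c P₂ w) α β) z =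
      (fderiv ℝ (fun w => bivector (P₁ w) (α.comp (inl ℝ V₁ V₂)) (β.comp (inl ℝ V₁ V₂))) z.1).comp
        (ContinuousLinearMap.fst ℝ V₁ V₂)
      + (c • fderiv ℝ (fun w => bivector (P₂ w) (α.comp (inr ℝ V₁ V₂))
          (β.comp (inr ℝ V₁ V₂))) z.2).comp (ContinuousLinearMap.snd ℝ V₁ V₂) := by
  have d1 := hasFDerivAt_comp_fst (z := z) ((h.left.bivector (α.comp (inl ℝ V₁ V₂)) (β.comp (inl ℝ V₁ V₂))).differentiableAt (by simp))
  have d2 := hasFDerivAt_comp_snd (z := z) ((h.right.bivector (α.comp (inr ℝ V₁ V₂)) (β.comp (inr ℝ V₁ V₂))).differentiableAt (by simp))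
  simp_rw [bivector_prodSharp]
  rw [(d1.fun_add (d2.const_mul c)).fderiv]
  ext <;> simp

theorem fderiv_sharp (h : IsWarpedAt g₁ P₁ f g₂ P₂ z) (c : ℝ) (α : V₁ × V₂ →L[ℝ] ℝ) (u : V₁ × V₂) :
    fderiv ℝ (fun w => prodSharp P₁ c P₂ w α) z u =
      (fderiv ℝ (fun w => P₁ w (α.comp (inl ℝ V₁ V₂))) z.1 u.1,
        c • fderiv ℝ (fun w => P₂ w (α.comp (inr ℝ V₁ V₂))) z.2 u.2) := by
  have d1 := hasFDerivAt_comp_fst (z := z) ((h.left.sharp_const (α.comp (inl ℝ V₁ V₂))).differentiableAt (by simp))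
  have d2 := hasFDerivAt_comp_snd (z := z) ((h.right.sharp_const (α.comp (inr ℝ V₁ V₂))).differentiableAt (by simp))
  simp_rw [prodSharp_apply]
  rw [(d1.prodMk (d2.fun_const_smul c)).fderiv]
  simp

/-- Used for `f⁻²` (`n = 1`) in the cometric and for `f⁻³` (`n = 2`) in the Christoffel form. The
shift by one avoids a natural-number subtraction in the exponent. -/
theorem hasFDerivAt_inv_pow (h : IsWarpedAt g₁ P₁ f g₂ P₂ z) (n : ℕ) :
    HasFDerivAt (fun w : V₁ × V₂ => (f w.1 ^ (n + 1))⁻¹)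
      ((-(n + 1 : ℝ) * (f z.1 ^ (n + 2))⁻¹) •
        (fderiv ℝ f z.1).comp (ContinuousLinearMap.fst ℝ V₁ V₂)) z := by
  have hf := (h.smooth.differentiableAt (by simp)).hasFDerivAt
  have h0 := h.ne_zero
  have h1 : HasDerivAt (fun t : ℝ => (t ^ (n + 1))⁻¹) (-(n + 1 : ℝ) * (f z.1 ^ (n + 2))⁻¹)
      (f z.1) := by
    refine ((hasDerivAt_pow (n + 1) (f z.1)).fun_inv (pow_ne_zero _ h0)).congr_deriv ?_
    rw [Nat.add_sub_cancel]
    push_cast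
    field_simp
    ring
  exact h1.comp_hasFDerivAt z (f := fun w : V₁ × V₂ => f w.1) (hf.comp z hasFDerivAt_fst)

/-- The bracket sees only the bivector, which splits into two pieces living on separate factors;
hence `f` is absent. A variable coefficient in place of `c` would contribute a multiple of its
differential. -/
theorem bracket_eq (h : IsWarpedAt g₁ P₁ f g₂ P₂ z) (c : ℝ) (α β : V₁ × V₂ →L[ℝ] ℝ) :
    bracket (prodSharp P₁ c P₂) (fun _ => α) (fun _ => β) z =
      (bracket P₁ (fun _ => α.comp (inl ℝ V₁ V₂)) (fun _ => β.comp (inl ℝ V₁ V₂)) z.1).comp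
        (ContinuousLinearMap.fst ℝ V₁ V₂)
      + (c • bracket P₂ (fun _ => α.comp (inr ℝ V₁ V₂)) (fun _ => β.comp (inr ℝ V₁ V₂)) z.2).comp
        (ContinuousLinearMap.snd ℝ V₁ V₂) := by
  refine ContinuousLinearMap.ext fun u => ?_
  simp only [bracket, lieDeriv, h.fderiv_bivector, add_apply, sub_apply, smul_apply,
    ContinuousLinearMap.comp_apply, h.fderiv_sharp, fderiv_fun_const, Pi.zero_apply, zero_apply,
    ContinuousLinearMap.coe_fst', ContinuousLinearMap.coe_snd', smul_eq_mul]
  rw [prod_comp_eq α, prod_comp_eq β]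
  simp only [ContinuousLinearMap.comp_apply, map_smul, smul_eq_mul]
  ring

variable [CompleteSpace V₁] [CompleteSpace V₂]

theorem eventually (h : IsWarpedAt g₁ P₁ f g₂ P₂ z) :
    ∀ᶠ w in 𝓝 z, IsWarpedAt g₁ P₁ f g₂ P₂ w := by
  have c1 := continuousAt_fst (p := z)
  have c2 := continuousAt_snd (p := z)
  filter_upwards [c1.eventually h.left.eventually, c2.eventually h.right.eventually,
    c1.eventually h.eventually_smooth.eventually_nhds,
    c1.eventually (h.smooth.continuousAt.eventually_ne h.ne_zero)]
    with w a b c d using ⟨a, b, c, d⟩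

theorem fderiv_musicalSharp (h : IsWarpedAt g₁ P₁ f g₂ P₂ z) (α : V₁ × V₂ →L[ℝ] ℝ) (u : V₁ × V₂) :
    fderiv ℝ (fun w => musicalSharp (prodMetric g₁ f g₂ w) α) z u =
      (fderiv ℝ (fun w => musicalSharp (g₁ w) (α.comp (inl ℝ V₁ V₂))) z.1 u.1,
        (-2 * (f z.1 ^ 3)⁻¹ * fderiv ℝ f z.1 u.1) •
            musicalSharp (g₂ z.2) (α.comp (inr ℝ V₁ V₂))
          + (f z.1 ^ 2)⁻¹ • fderiv ℝ (fun w => musicalSharp (g₂ w) (α.comp (inr ℝ V₁ V₂))) z.2 u.2) := by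
  have e : (fun w => musicalSharp (prodMetric g₁ f g₂ w) α) =ᶠ[𝓝 z] fun w =>
      (musicalSharp (g₁ w.1) (α.comp (inl ℝ V₁ V₂)),
      (f w.1 ^ 2)⁻¹ • musicalSharp (g₂ w.2) (α.comp (inr ℝ V₁ V₂))) := by
    filter_upwards [h.eventually] with w hw
    exact musicalSharp_prodMetric hw.left.invertible hw.right.invertible hw.ne_zero α
  have d1 := hasFDerivAt_comp_fst (z := z) ((h.left.musicalSharp_const (α.comp (inl ℝ V₁ V₂))).differentiableAt (by simp))
  have d2 := hasFDerivAt_comp_snd (z := z) ((h.right.musicalSharp_const (α.comp (inr ℝ V₁ V₂))).differentiableAt (by simp))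
  rw [e.fderiv_eq, (d1.prodMk ((h.hasFDerivAt_inv_pow 1).fun_smul d2)).fderiv]
  norm_num [add_comm]

theorem fderiv_cometric (h : IsWarpedAt g₁ P₁ f g₂ P₂ z) (α β : V₁ × V₂ →L[ℝ] ℝ) :
    fderiv ℝ (fun w => cometric (prodMetric g₁ f g₂ w) α β) z =
      (fderiv ℝ (fun w => cometric (g₁ w) (α.comp (inl ℝ V₁ V₂)) (β.comp (inl ℝ V₁ V₂))) z.1
        + (-2 * (f z.1 ^ 3)⁻¹ * cometric (g₂ z.2) (α.comp (inr ℝ V₁ V₂)) (β.comp (inr ℝ V₁ V₂))) •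
          fderiv ℝ f z.1).comp (ContinuousLinearMap.fst ℝ V₁ V₂)
      + ((f z.1 ^ 2)⁻¹ • fderiv ℝ (fun w => cometric (g₂ w) (α.comp (inr ℝ V₁ V₂))
          (β.comp (inr ℝ V₁ V₂))) z.2).comp (ContinuousLinearMap.snd ℝ V₁ V₂) := by
  have e : (fun w => cometric (prodMetric g₁ f g₂ w) α β) =ᶠ[𝓝 z] fun w =>
      cometric (g₁ w.1) (α.comp (inl ℝ V₁ V₂)) (β.comp (inl ℝ V₁ V₂))
        + (f w.1 ^ 2)⁻¹ * cometric (g₂ w.2) (α.comp (inr ℝ V₁ V₂)) (β.comp (inr ℝ V₁ V₂)) := by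
    filter_upwards [h.eventually] with w hw
    exact cometric_prodMetric hw.left.invertible hw.right.invertible hw.ne_zero α β
  have d1 := hasFDerivAt_comp_fst (z := z) ((h.left.cometric (α.comp (inl ℝ V₁ V₂)) (β.comp (inl ℝ V₁ V₂))).differentiableAt (by simp))
  have d2 := hasFDerivAt_comp_snd (z := z) ((h.right.cometric (α.comp (inr ℝ V₁ V₂)) (β.comp (inr ℝ V₁ V₂))).differentiableAt (by simp))
  rw [e.fderiv_eq, (d1.fun_add ((h.hasFDerivAt_inv_pow 1).fun_mul d2)).fderiv]
  ext <;> simp; ring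

/-- The contravariant Christoffel form of a warped product. -/
theorem christoffel_eq (h : IsWarpedAt g₁ P₁ f g₂ P₂ z) (c : ℝ) (α β : V₁ × V₂ →L[ℝ] ℝ) :
    christoffel (prodMetric g₁ f g₂) (prodSharp P₁ c P₂) z α β =
      (christoffel g₁ P₁ z.1 (α.comp (inl ℝ V₁ V₂)) (β.comp (inl ℝ V₁ V₂))
        - ((f z.1 ^ 3)⁻¹ * cometric (g₂ z.2) (α.comp (inr ℝ V₁ V₂)) (β.comp (inr ℝ V₁ V₂))) •
          endoJ (g₁ z.1) (P₁ z.1) (fderiv ℝ f z.1)).comp (ContinuousLinearMap.fst ℝ V₁ V₂)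
      + (c • christoffel g₂ P₂ z.2 (α.comp (inr ℝ V₁ V₂)) (β.comp (inr ℝ V₁ V₂))
        - ((f z.1)⁻¹ * fderiv ℝ f z.1 (P₁ z.1 (α.comp (inl ℝ V₁ V₂)))) • β.comp (inr ℝ V₁ V₂)
        - ((f z.1)⁻¹ * fderiv ℝ f z.1 (P₁ z.1 (β.comp (inl ℝ V₁ V₂)))) •
          α.comp (inr ℝ V₁ V₂)).comp (ContinuousLinearMap.snd ℝ V₁ V₂) := by
  have c1 : ∀ (a : V₁ →L[ℝ] ℝ) (b : V₂ →L[ℝ] ℝ), (a.comp (ContinuousLinearMap.fst ℝ V₁ V₂)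
      + b.comp (ContinuousLinearMap.snd ℝ V₁ V₂)).comp (inl ℝ V₁ V₂) = a := by
    intros; ext; simp
  have c2 : ∀ (a : V₁ →L[ℝ] ℝ) (b : V₂ →L[ℝ] ℝ), (a.comp (ContinuousLinearMap.fst ℝ V₁ V₂)
      + b.comp (ContinuousLinearMap.snd ℝ V₁ V₂)).comp (inr ℝ V₁ V₂) = b := by
    intros; ext; simp
  have h0 := h.ne_zero
  rw [christoffel, h.fderiv_musicalSharp, h.fderiv_musicalSharp, h.fderiv_cometric,
    h.fderiv_bivector, h.fderiv_sharp, h.fderiv_sharp,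
    musicalSharp_prodMetric h.left.invertible h.right.invertible h0,
    musicalSharp_prodMetric h.left.invertible h.right.invertible h0,
    musicalSharp_prodMetric h.left.invertible h.right.invertible h0,
    prodSharp_apply, prodSharp_apply, prodSharp_apply, c1, c2, c1, c2, christoffel, christoffel]
  -- Lowering the index multiplies the vertical component by `f²`, which cancels the `f⁻²` of the
  -- sharp. The terms with `-2 f⁻³ df` become the `f⁻¹ df` corrections there. In the horizontal
  -- component the same derivative, coming from the cometric, gives `-f⁻³ g̃₂ J₁df`.
  refine ContinuousLinearMap.ext fun u => ?_
  simp only [smul_apply, prodMetric_apply, add_apply, sub_apply,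
    ContinuousLinearMap.comp_apply, ContinuousLinearMap.coe_fst', ContinuousLinearMap.coe_snd',
    map_add, map_sub, map_smul, endoJ,
    smul_eq_mul, apply_musicalSharp h.right.invertible]
  field_simp
  ring

end IsWarpedAt

end LocalWarped

/-! ### Curvature of a warped product of vector spaces. -/

section LocalCurvature

variable {V₁ : Type*} [NormedAddCommGroup V₁] [NormedSpace ℝ V₁]
  {V₂ : Type*} [NormedAddCommGroup V₂] [NormedSpace ℝ V₂]

open ContinuousLinearMap (inl inr precomp)

theorem comp_fst_inl (a : V₁ →L[ℝ] ℝ) :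
    (a.comp (ContinuousLinearMap.fst ℝ V₁ V₂)).comp (inl ℝ V₁ V₂) = a := by ext; simp

theorem comp_fst_inr (a : V₁ →L[ℝ] ℝ) :
    (a.comp (ContinuousLinearMap.fst ℝ V₁ V₂)).comp (inr ℝ V₁ V₂) = 0 := by ext; simp

theorem comp_snd_inl (b : V₂ →L[ℝ] ℝ) :
    (b.comp (ContinuousLinearMap.snd ℝ V₁ V₂)).comp (inl ℝ V₁ V₂) = 0 := by ext; simp

theorem comp_snd_inr (b : V₂ →L[ℝ] ℝ) :
    (b.comp (ContinuousLinearMap.snd ℝ V₁ V₂)).comp (inr ℝ V₁ V₂) = b := by ext; simp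

section Linearity

variable {V : Type*} [NormedAddCommGroup V] [NormedSpace ℝ V]
  {g : V → V →L[ℝ] V →L[ℝ] ℝ} {P : V → (V →L[ℝ] ℝ) →L[ℝ] V} {y : V}

theorem christoffel_zero_left (a : V →L[ℝ] ℝ) : christoffel g P y 0 a = 0 := by
  simp [christoffel, cometric, bivector]

theorem christoffel_zero_right (a : V →L[ℝ] ℝ) : christoffel g P y a 0 = 0 := by
  simp [christoffel, cometric, bivector]

/-- Every term of `Γ(a, b)` is linear in `b`. This extracts the scalar `f⁻³ g̃₂(b, b)` from `Γ₁(a,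
·)` in the mixed curvature. -/
theorem christoffel_smul_right [CompleteSpace V] (h : IsSmoothPair g P y) (t : ℝ)
    (a b : V →L[ℝ] ℝ) : christoffel g P y a (t • b) = t • christoffel g P y a b := by
  have d1 := (h.musicalSharp_const b).differentiableAt (by simp)
  have d2 := (h.cometric a b).differentiableAt (by simp)
  have d3 := (h.bivector a b).differentiableAt (by simp)
  have d4 := (h.sharp_const b).differentiableAt (by simp)
  have e2 : (fun z => cometric (g z) a (t • b)) = fun z => t • cometric (g z) a b := by
    funext z; simp [cometric]
  have e3 : (fun z => bivector (P z) a (t • b)) = fun z => t • bivector (P z) a b := rfl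
  simp only [christoffel, e2, e3, map_smul, fderiv_fun_const_smul d1, fderiv_fun_const_smul d2,
    fderiv_fun_const_smul d3, fderiv_fun_const_smul d4, smul_apply, ← smul_add, ← smul_sub]
  rw [smul_comm]

theorem cometric_smul_left (G : V →L[ℝ] V →L[ℝ] ℝ) (t : ℝ) (a b : V →L[ℝ] ℝ) :
    cometric G (t • a) b = t * cometric G a b := by
  simp [cometric]

theorem cometric_smul_right (G : V →L[ℝ] V →L[ℝ] ℝ) (t : ℝ) (a b : V →L[ℝ] ℝ) :
    cometric G a (t • b) = t * cometric G a b := by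
  simp [cometric]

theorem cometric_add_left (G : V →L[ℝ] V →L[ℝ] ℝ) (a b c : V →L[ℝ] ℝ) :
    cometric G (a + b) c = cometric G a c + cometric G b c := by
  simp [cometric]

theorem cometric_zero_left (G : V →L[ℝ] V →L[ℝ] ℝ) (a : V →L[ℝ] ℝ) : cometric G 0 a = 0 := by
  simp [cometric]

theorem cometric_zero_right (G : V →L[ℝ] V →L[ℝ] ℝ) (a : V →L[ℝ] ℝ) : cometric G a 0 = 0 := by
  simp [cometric]

end Linearity

namespace IsWarpedAt

variable [CompleteSpace V₁] [CompleteSpace V₂]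
  {g₁ : V₁ → V₁ →L[ℝ] V₁ →L[ℝ] ℝ} {P₁ : V₁ → (V₁ →L[ℝ] ℝ) →L[ℝ] V₁} {f : V₁ → ℝ}
  {g₂ : V₂ → V₂ →L[ℝ] V₂ →L[ℝ] ℝ} {P₂ : V₂ → (V₂ →L[ℝ] ℝ) →L[ℝ] V₂} {z : V₁ × V₂}

theorem christoffel_fst_fst (h : IsWarpedAt g₁ P₁ f g₂ P₂ z) (c : ℝ) (a b : V₁ →L[ℝ] ℝ) :
    christoffel (prodMetric g₁ f g₂) (prodSharp P₁ c P₂) z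
        (a.comp (ContinuousLinearMap.fst ℝ V₁ V₂)) (b.comp (ContinuousLinearMap.fst ℝ V₁ V₂))
      = (christoffel g₁ P₁ z.1 a b).comp (ContinuousLinearMap.fst ℝ V₁ V₂) := by
  rw [h.christoffel_eq]
  simp [comp_fst_inl, comp_fst_inr, christoffel_zero_left, cometric_zero_left]

/-- Both `Γ₁` and `Γ₂` vanish when one argument is zero, so only the derivative of the warping
function along `♯₁a` survives. -/
theorem christoffel_fst_snd (h : IsWarpedAt g₁ P₁ f g₂ P₂ z) (c : ℝ) (a : V₁ →L[ℝ] ℝ)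
    (b : V₂ →L[ℝ] ℝ) :
    christoffel (prodMetric g₁ f g₂) (prodSharp P₁ c P₂) z
        (a.comp (ContinuousLinearMap.fst ℝ V₁ V₂)) (b.comp (ContinuousLinearMap.snd ℝ V₁ V₂))
      = (-((f z.1)⁻¹ * fderiv ℝ f z.1 (P₁ z.1 a))) •
        b.comp (ContinuousLinearMap.snd ℝ V₁ V₂) := by
  rw [h.christoffel_eq]
  ext <;> simp [comp_fst_inl, comp_fst_inr, comp_snd_inl, comp_snd_inr, christoffel_zero_left,
    christoffel_zero_right, cometric_zero_left]

theorem christoffel_snd_snd (h : IsWarpedAt g₁ P₁ f g₂ P₂ z) (c : ℝ) (b b' : V₂ →L[ℝ] ℝ) :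
    christoffel (prodMetric g₁ f g₂) (prodSharp P₁ c P₂) z
        (b.comp (ContinuousLinearMap.snd ℝ V₁ V₂)) (b'.comp (ContinuousLinearMap.snd ℝ V₁ V₂))
      = ((-((f z.1 ^ 3)⁻¹ * cometric (g₂ z.2) b b')) •
          endoJ (g₁ z.1) (P₁ z.1) (fderiv ℝ f z.1)).comp (ContinuousLinearMap.fst ℝ V₁ V₂)
        + (c • christoffel g₂ P₂ z.2 b b').comp (ContinuousLinearMap.snd ℝ V₁ V₂) := by
  rw [h.christoffel_eq]
  ext <;> simp [comp_snd_inl, comp_snd_inr, christoffel_zero_left]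

/-- On horizontal covectors the curvature of a warped product is that of the base. -/
theorem curvature_fst (h : IsWarpedAt g₁ P₁ f g₂ P₂ z) (c : ℝ) (a b d : V₁ →L[ℝ] ℝ) :
    curvature (prodMetric g₁ f g₂) (prodSharp P₁ c P₂) z
        (a.comp (ContinuousLinearMap.fst ℝ V₁ V₂)) (b.comp (ContinuousLinearMap.fst ℝ V₁ V₂))
        (d.comp (ContinuousLinearMap.fst ℝ V₁ V₂))
      = (curvature g₁ P₁ z.1 a b d).comp (ContinuousLinearMap.fst ℝ V₁ V₂) := by
  have hd : ∀ (a b : V₁ →L[ℝ] ℝ) (u : V₁ × V₂), fderiv ℝ (fun w =>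
      christoffel (prodMetric g₁ f g₂) (prodSharp P₁ c P₂) w
        (a.comp (ContinuousLinearMap.fst ℝ V₁ V₂)) (b.comp (ContinuousLinearMap.fst ℝ V₁ V₂))) z u
      = (fderiv ℝ (fun w => christoffel g₁ P₁ w a b) z.1 u.1).comp
        (ContinuousLinearMap.fst ℝ V₁ V₂) := fun a b u => by
    have e : (fun w => christoffel (prodMetric g₁ f g₂) (prodSharp P₁ c P₂) w
        (a.comp (ContinuousLinearMap.fst ℝ V₁ V₂)) (b.comp (ContinuousLinearMap.fst ℝ V₁ V₂)))
        =ᶠ[𝓝 z] fun w => precomp ℝ (ContinuousLinearMap.fst ℝ V₁ V₂)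
          (christoffel g₁ P₁ w.1 a b) := by
      filter_upwards [h.eventually] with w hw
      exact hw.christoffel_fst_fst c a b
    have d1 := hasFDerivAt_comp_fst (z := z) ((h.left.christoffel a b).differentiableAt (by simp))
    have d2 := (precomp ℝ (ContinuousLinearMap.fst ℝ V₁ V₂)).hasFDerivAt.comp z d1
    exact congrArg (fun L => L u) (e.fderiv_eq.trans d2.fderiv)
  have hb : bracket (prodSharp P₁ c P₂) (fun _ => a.comp (ContinuousLinearMap.fst ℝ V₁ V₂))
      (fun _ => b.comp (ContinuousLinearMap.fst ℝ V₁ V₂)) z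
      = (bracket P₁ (fun _ => a) (fun _ => b) z.1).comp (ContinuousLinearMap.fst ℝ V₁ V₂) := by
    rw [h.bracket_eq]
    simp [comp_fst_inl, comp_fst_inr, bracket, lieDeriv, bivector]
  rw [curvature_eq, curvature_eq, hd, hd, hb]
  simp only [h.christoffel_fst_fst, prodSharp_apply, comp_fst_inl,
    ContinuousLinearMap.add_comp, ContinuousLinearMap.sub_comp]

theorem sectional_fst (h : IsWarpedAt g₁ P₁ f g₂ P₂ z) (c : ℝ) (a b : V₁ →L[ℝ] ℝ) :
    sectional (prodMetric g₁ f g₂) (prodSharp P₁ c P₂) z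
        (a.comp (ContinuousLinearMap.fst ℝ V₁ V₂)) (b.comp (ContinuousLinearMap.fst ℝ V₁ V₂))
      = sectional g₁ P₁ z.1 a b := by
  have hc : ∀ a b : V₁ →L[ℝ] ℝ, cometric (prodMetric g₁ f g₂ z)
      (a.comp (ContinuousLinearMap.fst ℝ V₁ V₂)) (b.comp (ContinuousLinearMap.fst ℝ V₁ V₂))
      = cometric (g₁ z.1) a b := fun a b => by
    rw [cometric_prodMetric h.left.invertible h.right.invertible h.ne_zero]
    simp [comp_fst_inl, comp_fst_inr, cometric_zero_left]
  rw [sectional, sectional, h.curvature_fst]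
  simp only [hc]

/-- The horizontal part of the mixed curvature `ℛ(a, b) b` of a warped product, for `a` horizontal
and `b` vertical. -/
theorem curvature_fst_snd_inl (h : IsWarpedAt g₁ P₁ f g₂ P₂ z) (c : ℝ) (a : V₁ →L[ℝ] ℝ)
    (b : V₂ →L[ℝ] ℝ) :
    (curvature (prodMetric g₁ f g₂) (prodSharp P₁ c P₂) z
        (a.comp (ContinuousLinearMap.fst ℝ V₁ V₂)) (b.comp (ContinuousLinearMap.snd ℝ V₁ V₂))
        (b.comp (ContinuousLinearMap.snd ℝ V₁ V₂))).comp (inl ℝ V₁ V₂)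
      = (-((f z.1 ^ 3)⁻¹ * cometric (g₂ z.2) b b)) • leviCivita g₁ P₁ (fun _ => a)
          (fun w => endoJ (g₁ w) (P₁ w) (fderiv ℝ f w)) z.1
        + (2 * (f z.1 ^ 4)⁻¹ * fderiv ℝ f z.1 (P₁ z.1 a) * cometric (g₂ z.2) b b) •
          endoJ (g₁ z.1) (P₁ z.1) (fderiv ℝ f z.1) := by
  set A := a.comp (ContinuousLinearMap.fst ℝ V₁ V₂) with hA
  set B := b.comp (ContinuousLinearMap.snd ℝ V₁ V₂) with hB
  have h0 := h.ne_zero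
  have dJ := (h.left.endoJ h.smooth).differentiableAt (by simp)
  have e1 : (fun w => christoffel (prodMetric g₁ f g₂) (prodSharp P₁ c P₂) w B B) =ᶠ[𝓝 z]
      fun w => precomp ℝ (ContinuousLinearMap.fst ℝ V₁ V₂) ((-((f w.1 ^ 3)⁻¹ *
          cometric (g₂ w.2) b b)) • endoJ (g₁ w.1) (P₁ w.1) (fderiv ℝ f w.1))
        + precomp ℝ (ContinuousLinearMap.snd ℝ V₁ V₂) (c • christoffel g₂ P₂ w.2 b b) := by
    filter_upwards [h.eventually] with w hw
    exact hw.christoffel_snd_snd c b b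
  have d1 := ((h.hasFDerivAt_inv_pow 2).fun_mul (hasFDerivAt_comp_snd (z := z)
    ((h.right.cometric b b).differentiableAt (by simp)))).fun_neg.fun_smul
    (hasFDerivAt_comp_fst (z := z) dJ)
  have d2 := (hasFDerivAt_comp_snd (z := z)
    ((h.right.christoffel b b).differentiableAt (by simp))).fun_const_smul c
  have e2 : (fun w => christoffel (prodMetric g₁ f g₂) (prodSharp P₁ c P₂) w A B) =ᶠ[𝓝 z]
      fun w => (-((f w.1)⁻¹ * fderiv ℝ f w.1 (P₁ w.1 a))) • B := by
    filter_upwards [h.eventually] with w hw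
    exact hw.christoffel_fst_snd c a b
  have d3 : DifferentiableAt ℝ (fun w : V₁ × V₂ => -((f w.1)⁻¹ * fderiv ℝ f w.1 (P₁ w.1 a))) z := by
    have hi : ContDiffAt ℝ ∞ (fun w => (f w)⁻¹ * fderiv ℝ f w (P₁ w a)) z.1 :=
      (h.smooth.inv h0).mul
        ((h.smooth.fderiv_right (m := ∞) (by simp)).clm_apply (h.left.sharp_const a))
    exact (hasFDerivAt_comp_fst (z := z) (hi.differentiableAt (by simp))).differentiableAt.neg
  -- Horizontal and vertical constant forms commute, so the third term of the curvature drops out.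
  have hb : bracket (prodSharp P₁ c P₂) (fun _ => A) (fun _ => B) z = 0 := by
    rw [h.bracket_eq]
    simp [hA, hB, comp_fst_inl, comp_fst_inr, comp_snd_inl, comp_snd_inr, bracket, lieDeriv, bivector]
  have f1 := (((precomp ℝ (ContinuousLinearMap.fst ℝ V₁ V₂)).hasFDerivAt.comp z d1).add
    ((precomp ℝ (ContinuousLinearMap.snd ℝ V₁ V₂)).hasFDerivAt.comp z d2)).fderiv
  have f1' := e1.fderiv_eq.trans f1
  have hQ : prodSharp P₁ c P₂ z A = (P₁ z.1 a, 0) := by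
    rw [prodSharp_apply, hA, comp_fst_inl, comp_fst_inr, map_zero, smul_zero]
  -- The direction `♯A` has no vertical component, so `g̃₂(b, b)` is not differentiated; the
  -- derivative of `-f⁻³` produces the coefficient `3 f⁻⁴`.
  have F1 : (fderiv ℝ (fun w => christoffel (prodMetric g₁ f g₂) (prodSharp P₁ c P₂) w B B) z
      (prodSharp P₁ c P₂ z A)).comp (inl ℝ V₁ V₂)
      = (-((f z.1 ^ 3)⁻¹ * cometric (g₂ z.2) b b)) •
          fderiv ℝ (fun w => endoJ (g₁ w) (P₁ w) (fderiv ℝ f w)) z.1 (P₁ z.1 a)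
        + (3 * (f z.1 ^ 4)⁻¹ * fderiv ℝ f z.1 (P₁ z.1 a) * cometric (g₂ z.2) b b) •
          endoJ (g₁ z.1) (P₁ z.1) (fderiv ℝ f z.1) := by
    rw [f1', hQ]
    ext u
    simp
    ring
  have F2 : (christoffel (prodMetric g₁ f g₂) (prodSharp P₁ c P₂) z A
      (christoffel (prodMetric g₁ f g₂) (prodSharp P₁ c P₂) z B B)).comp (inl ℝ V₁ V₂)
      = (-((f z.1 ^ 3)⁻¹ * cometric (g₂ z.2) b b)) • christoffel g₁ P₁ z.1 a
          (endoJ (g₁ z.1) (P₁ z.1) (fderiv ℝ f z.1)) := by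
    rw [h.christoffel_snd_snd, h.christoffel_eq, ← christoffel_smul_right h.left]
    simp only [hA, ContinuousLinearMap.add_comp, comp_fst_inl, comp_fst_inr, comp_snd_inl,
      cometric_zero_left, mul_zero, zero_smul, sub_zero, add_zero]
  -- Near `z` this Christoffel form is a function times the fixed vertical covector `B`, so its
  -- derivative is vertical too.
  have F3 : (fderiv ℝ (fun w => christoffel (prodMetric g₁ f g₂) (prodSharp P₁ c P₂) w A B) z
      (prodSharp P₁ c P₂ z B)).comp (inl ℝ V₁ V₂) = 0 := by
    rw [e2.fderiv_eq.trans (d3.hasFDerivAt.smul_const B).fderiv]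
    ext u
    simp [hB]
  have F4 : (christoffel (prodMetric g₁ f g₂) (prodSharp P₁ c P₂) z B
      (christoffel (prodMetric g₁ f g₂) (prodSharp P₁ c P₂) z A B)).comp (inl ℝ V₁ V₂)
      = ((f z.1 ^ 4)⁻¹ * fderiv ℝ f z.1 (P₁ z.1 a) * cometric (g₂ z.2) b b) •
          endoJ (g₁ z.1) (P₁ z.1) (fderiv ℝ f z.1) := by
    rw [h.christoffel_fst_snd, h.christoffel_eq]
    simp only [hB, ContinuousLinearMap.add_comp, ContinuousLinearMap.smul_comp, comp_fst_inl,
      comp_snd_inl, comp_snd_inr, christoffel_zero_left, smul_zero, cometric_smul_right, zero_sub,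
      add_zero]
    ext u
    simp only [smul_apply, neg_apply, smul_eq_mul]
    ring
  -- `F1` and `F2` combine into the covariant derivative of `J₁df`. The coefficient `2` of `J₁df` is
  -- the `3` of `F1` minus the `1` of `F4`.
  rw [curvature_eq, hb, christoffel_zero_left, sub_zero, ContinuousLinearMap.sub_comp,
    ContinuousLinearMap.add_comp, ContinuousLinearMap.add_comp, F1, F2, F3, F4, leviCivita]
  ext u
  simp
  ring

/-- The mixed sectional curvature of a warped product, for a timelike unit covector `a` of the base
and a covector `b` of the fibre which has unit length in the warped product. -/
theorem sectional_fst_snd (h : IsWarpedAt g₁ P₁ f g₂ P₂ z) (c : ℝ) {a : V₁ →L[ℝ] ℝ}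
    {b : V₂ →L[ℝ] ℝ} (ha : cometric (g₁ z.1) a a = -1) (hb : cometric (g₂ z.2) b b = f z.1 ^ 2)
    (hJ : cometric (g₁ z.1) (endoJ (g₁ z.1) (P₁ z.1) (fderiv ℝ f z.1)) a
      = -fderiv ℝ f z.1 (P₁ z.1 a)) :
    sectional (prodMetric g₁ f g₂) (prodSharp P₁ c P₂) z
        (a.comp (ContinuousLinearMap.fst ℝ V₁ V₂)) (b.comp (ContinuousLinearMap.snd ℝ V₁ V₂))
      = hessian g₁ P₁ f z.1 a a / f z.1
        + 2 * cometric (g₁ z.1) (endoJ (g₁ z.1) (P₁ z.1) (fderiv ℝ f z.1)) a ^ 2 / f z.1 ^ 2 := by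
  have h0 := h.ne_zero
  rw [sectional, cometric_prodMetric h.left.invertible h.right.invertible h0,
    cometric_prodMetric h.left.invertible h.right.invertible h0,
    cometric_prodMetric h.left.invertible h.right.invertible h0,
    cometric_prodMetric h.left.invertible h.right.invertible h0, h.curvature_fst_snd_inl]
  -- Pairing with the horizontal `a` kills the vertical part of the curvature, which is why only its
  -- horizontal part was computed. The denominator is `(-1) · (f⁻² f²) - 0 = -1`.
  simp only [comp_fst_inl, comp_fst_inr, comp_snd_inl, comp_snd_inr, cometric_zero_left,
    cometric_zero_right, ha, hb, cometric_add_left, cometric_smul_left, hJ, hessian]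
  field_simp
  ring

end IsWarpedAt

end LocalCurvature

/-! ### Nondegenerate forms and changes of coordinates. -/

theorem isInvertible_of_nondegenerate {E : Type*} [NormedAddCommGroup E] [NormedSpace ℝ E]
    [FiniteDimensional ℝ E] (g : E →L[ℝ] E →L[ℝ] ℝ) (hg : ∀ v, (∀ w, g v w = 0) → v = 0) :
    g.IsInvertible := by
  have hinj : Function.Injective (g : E →ₗ[ℝ] E →L[ℝ] ℝ) := by
    rw [← LinearMap.ker_eq_bot, LinearMap.ker_eq_bot']
    intro v hv
    exact hg v fun w => congrArg (fun L : E →L[ℝ] ℝ => L w) hv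
  have hrank : Module.finrank ℝ E = Module.finrank ℝ (E →L[ℝ] ℝ) := by
    rw [← (LinearMap.toContinuousLinearMap (𝕜 := ℝ) (E := E) (F' := ℝ)).finrank_eq]
    exact Subspace.dual_finrank_eq.symm
  exact ⟨(LinearEquiv.ofInjectiveOfFinrankEq (g : E →ₗ[ℝ] E →L[ℝ] ℝ) hinj
    hrank).toContinuousLinearEquiv, by ext; rfl⟩

/-- The cometric is invariant under linear changes of coordinates. -/
theorem cometric_precomp {E : Type*} [NormedAddCommGroup E] [NormedSpace ℝ E]
    {g : E →L[ℝ] E →L[ℝ] ℝ} (hg : g.IsInvertible) {A B : E →L[ℝ] E} (hAB : ∀ v, A (B v) = v)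
    (hBA : ∀ v, B (A v) = v) (a b : E →L[ℝ] ℝ) :
    cometric ((ContinuousLinearMap.precomp ℝ A).comp (g.comp A)) (a.comp A) (b.comp A)
      = cometric g a b := by
  set G := (ContinuousLinearMap.precomp ℝ A).comp (g.comp A) with hG
  obtain ⟨e, rfl⟩ := hg
  have hinv : G.IsInvertible := by
    -- The inverse of the pulled-back metric `A* g A` is `B g⁻¹ B*`.
    refine .of_inverse (g := B.comp ((e.symm : (E →L[ℝ] ℝ) →L[ℝ] E).comp
      (ContinuousLinearMap.precomp ℝ B))) ?_ ?_
    · ext α v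
      simp [hG, hAB, hBA]
    · ext v
      have : ((e (A v)).comp A).comp B = e (A v) := by ext; simp [hAB]
      simp [hG, this, hBA]
  have hs : ∀ a : E →L[ℝ] ℝ, musicalSharp G (a.comp A) = B (musicalSharp (e : E →L[ℝ] E →L[ℝ] ℝ) a) := by
    intro a
    rw [← musicalSharp_apply hinv (B _)]
    congr 1
    ext v
    have := apply_musicalSharp ⟨e, rfl⟩ a (g := (e : E →L[ℝ] E →L[ℝ] ℝ))
    simp only [hG, ContinuousLinearMap.comp_apply, ContinuousLinearMap.precomp_apply, hAB, this]
  rw [cometric, hs, hs, cometric]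
  simp [hG, hAB]

/-! ### Coordinate expressions in the preferred chart. -/

section Charts

variable {E : Type*} [NormedAddCommGroup E] [NormedSpace ℝ E]
  {H : Type*} [TopologicalSpace H] {I : ModelWithCorners ℝ E H}
  {M : Type*} [TopologicalSpace M] [ChartedSpace H M]

/-- A metric on `M`, as a family of bilinear forms on the model space. -/
def modelMetric (g : MetricField I M) : M → E →L[ℝ] E →L[ℝ] ℝ := g

/-- A sharp map on `M`, as a family of maps on the model space. -/
def modelSharp (P : SharpField I M) : M → (E →L[ℝ] ℝ) →L[ℝ] E := P

/-- The derivative of the inverse of the preferred chart at `p`, as an endomorphism of `E`. -/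
def dChartSymm (I : ModelWithCorners ℝ E H) (p : M) (y : E) : E →L[ℝ] E :=
  mfderiv 𝓘(ℝ, E) I (extChartAt I p).symm y

/-- The derivative of the preferred chart at `p`, as an endomorphism of `E`. -/
def dChart (I : ModelWithCorners ℝ E H) (p : M) (y : E) : E →L[ℝ] E :=
  mfderiv I 𝓘(ℝ, E) (extChartAt I p) ((extChartAt I p).symm y)

theorem readMetric_apply (g : MetricField I M) (p : M) (y v w : E) :
    readMetric g p y v w = modelMetric g ((extChartAt I p).symm y) (dChartSymm I p y v)
      (dChartSymm I p y w) := rfl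

theorem readSharp_apply (P : SharpField I M) (p : M) (y : E) (α : E →L[ℝ] ℝ) :
    readSharp P p y α = dChart I p y (modelSharp P ((extChartAt I p).symm y)
      (α.comp (dChart I p y))) := rfl

variable [IsManifold I ∞ M]

theorem mdifferentiableAt_extChartAt_of_target {p : M} {y : E}
    (hy : y ∈ (extChartAt I p).target) :
    MDifferentiableAt I 𝓘(ℝ, E) (extChartAt I p) ((extChartAt I p).symm y) := by
  have : IsManifold I 1 M := .of_le (n := ∞) (by simp)
  refine mdifferentiableAt_extChartAt ?_
  rw [← extChartAt_source (I := I)]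
  exact (extChartAt I p).map_target hy

variable [I.Boundaryless]

theorem mdifferentiableAt_extChartAt_symm {p : M} {y : E} (hy : y ∈ (extChartAt I p).target) :
    MDifferentiableAt 𝓘(ℝ, E) I (extChartAt I p).symm y := by
  have : IsManifold I 1 M := .of_le (n := ∞) (by simp)
  have h := mdifferentiableWithinAt_extChartAt_symm hy
  rwa [I.range_eq_univ, mdifferentiableWithinAt_univ] at h

/-- Without boundary the model has full range, so derivatives within the range are ordinary ones. -/
theorem dChart_dChartSymm {p : M} {y : E} (hy : y ∈ (extChartAt I p).target) (v : E) :
    dChart I p y (dChartSymm I p y v) = v := by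
  have : IsManifold I 1 M := .of_le (n := ∞) (by simp)
  have h := mfderiv_extChartAt_comp_mfderivWithin_extChartAt_symm hy
  rw [I.range_eq_univ, mfderivWithin_univ] at h
  exact congrArg (fun L : E →L[ℝ] E => L v) h

theorem dChartSymm_dChart {p : M} {y : E} (hy : y ∈ (extChartAt I p).target) (v : E) :
    dChartSymm I p y (dChart I p y v) = v := by
  have : IsManifold I 1 M := .of_le (n := ∞) (by simp)
  have h := mfderivWithin_extChartAt_symm_comp_mfderiv_extChartAt hy
  rw [I.range_eq_univ, mfderivWithin_univ] at h
  exact congrArg (fun L : E →L[ℝ] E => L v) h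

theorem isInvertible_readMetric [FiniteDimensional ℝ E] {g : MetricField I M}
    (hg : ∀ (x : M) (v : TangentSpace I x), (∀ w, g x v w = 0) → v = 0)
    {p : M} {y : E} (hy : y ∈ (extChartAt I p).target) : (readMetric g p y).IsInvertible := by
  refine isInvertible_of_nondegenerate _ fun v hv => ?_
  have h1 : ∀ w, modelMetric g ((extChartAt I p).symm y) (dChartSymm I p y v) w = 0 := fun w => by
    have := hv (dChart I p y w)
    rwa [readMetric_apply, dChartSymm_dChart hy] at this
  have h0 : dChartSymm I p y v = 0 := hg _ _ h1
  rw [← dChart_dChartSymm hy v, h0, map_zero]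

theorem isSmoothPair_read [FiniteDimensional ℝ E] {g : MetricField I M} {P : SharpField I M}
    (hg : ∀ p : M, ContDiffOn ℝ ∞ (readMetric g p) (extChartAt I p).target)
    (hn : ∀ (x : M) (v : TangentSpace I x), (∀ w, g x v w = 0) → v = 0)
    (hP : ∀ p : M, ContDiffOn ℝ ∞ (readSharp P p) (extChartAt I p).target) (p : M) :
    IsSmoothPair (readMetric g p) (readSharp P p) (extChartAt I p p) := by
  have ho := isOpen_extChartAt_target (I := I) p
  have hm := ho.mem_nhds (mem_extChartAt_target (I := I) p)
  refine ⟨?_, isInvertible_readMetric hn (mem_extChartAt_target p), ?_⟩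
  · filter_upwards [hm] with y hy using (hg p).contDiffAt (ho.mem_nhds hy)
  · filter_upwards [hm] with y hy using (hP p).contDiffAt (ho.mem_nhds hy)

theorem contDiffAt_read {f : M → ℝ} (hf : ContMDiff I 𝓘(ℝ, ℝ) ∞ f) {p : M} {y : E}
    (hy : y ∈ (extChartAt I p).target) :
    ContDiffAt ℝ ∞ (fun z => f ((extChartAt I p).symm z)) y := by
  have h : ContMDiffOn 𝓘(ℝ, E) 𝓘(ℝ, ℝ) ∞ (f ∘ (extChartAt I p).symm) (extChartAt I p).target :=
    hf.comp_contMDiffOn (contMDiffOn_extChartAt_symm p)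
  exact (contMDiffOn_iff_contDiffOn.1 h).contDiffAt ((isOpen_extChartAt_target p).mem_nhds hy)

theorem cometric_read [FiniteDimensional ℝ E] {g : MetricField I M}
    (hg : ∀ (x : M) (v : TangentSpace I x), (∀ w, g x v w = 0) → v = 0) (p : M)
    (a b : Cotangent I p) :
    cometric (readMetric g p (extChartAt I p p)) (readCovector p a) (readCovector p b)
      = cometric (g p) a b := by
  have hi : (modelMetric g p).IsInvertible := isInvertible_of_nondegenerate _ (hg p)
  have hy := mem_extChartAt_target (I := I) p
  have hp : modelMetric g ((extChartAt I p).symm (extChartAt I p p)) = modelMetric g p := by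
    rw [extChartAt_to_inv]
  have hr : readMetric g p (extChartAt I p p)
      = (ContinuousLinearMap.precomp ℝ (dChartSymm I p (extChartAt I p p))).comp
        ((modelMetric g p).comp (dChartSymm I p (extChartAt I p p))) := by
    rw [← hp]; rfl
  rw [hr]
  exact cometric_precomp hi (dChartSymm_dChart hy) (dChart_dChartSymm hy) a b

theorem fderiv_read {f : M → ℝ} (hf : ContMDiff I 𝓘(ℝ, ℝ) ∞ f) (p : M) :
    fderiv ℝ (fun z => f ((extChartAt I p).symm z)) (extChartAt I p p)
      = readCovector p (differential I f p) := by
  have hy := mem_extChartAt_target (I := I) p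
  have hp := extChartAt_to_inv (I := I) p
  have h := mfderiv_comp (I' := I) (extChartAt I p p)
    ((hf.mdifferentiable (by simp)) ((extChartAt I p).symm (extChartAt I p p)))
    (mdifferentiableAt_extChartAt_symm hy)
  rw [mfderiv_eq_fderiv] at h
  refine h.trans ?_
  -- Tangent spaces are copies of `E` by definition. Viewing `df` as a non-dependent function lets
  -- the base point be rewritten to `p`.
  let d : M → E →L[ℝ] ℝ := fun x => mfderiv I 𝓘(ℝ, ℝ) f x
  have hd : d ((extChartAt I p).symm (extChartAt I p p)) = d p := by rw [hp]
  exact congrArg (fun L : E →L[ℝ] ℝ => L.comp (dChartSymm I p (extChartAt I p p))) hd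

/-- In the composite of metric and sharp map, the derivatives of the chart and of its inverse meet
and cancel, so `J` is natural under the chart. -/
theorem endoJ_read (g : MetricField I M) (P : SharpField I M) (p : M) (a : Cotangent I p) :
    endoJ (readMetric g p (extChartAt I p p)) (readSharp P p (extChartAt I p p)) (readCovector p a)
      = readCovector p (endoJ (g p) (P p) a) := by
  let a' : E →L[ℝ] ℝ := a
  have hy := mem_extChartAt_target (I := I) p
  have hp := extChartAt_to_inv (I := I) p
  have ha : (a'.comp (dChartSymm I p (extChartAt I p p))).comp (dChart I p (extChartAt I p p))
      = a' := by
    ext v; exact congrArg a' (dChartSymm_dChart hy v)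
  refine ContinuousLinearMap.ext fun v => ?_
  have e : modelMetric g ((extChartAt I p).symm (extChartAt I p p))
      (dChartSymm I p (extChartAt I p p) (dChart I p (extChartAt I p p)
        (modelSharp P ((extChartAt I p).symm (extChartAt I p p))
          ((a'.comp (dChartSymm I p (extChartAt I p p))).comp (dChart I p (extChartAt I p p))))))
      (dChartSymm I p (extChartAt I p p) v) = modelMetric g p (modelSharp P p a') (dChartSymm I p (extChartAt I p p) v) := by
    rw [dChartSymm_dChart hy, ha, hp]
  exact e

end Charts

/-! ### The warped product in a product chart. -/

section ProductCharts

variable {E₁ : Type*} [NormedAddCommGroup E₁] [NormedSpace ℝ E₁]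
  {H₁ : Type*} [TopologicalSpace H₁] {I₁ : ModelWithCorners ℝ E₁ H₁}
  {M₁ : Type*} [TopologicalSpace M₁] [ChartedSpace H₁ M₁]
  {E₂ : Type*} [NormedAddCommGroup E₂] [NormedSpace ℝ E₂]
  {H₂ : Type*} [TopologicalSpace H₂] {I₂ : ModelWithCorners ℝ E₂ H₂}
  {M₂ : Type*} [TopologicalSpace M₂] [ChartedSpace H₂ M₂]

theorem mem_extChartAt_prod_target {p : M₁ × M₂} {y : E₁ × E₂} :
    y ∈ (extChartAt (I₁.prod I₂) p).target
      ↔ y.1 ∈ (extChartAt I₁ p.1).target ∧ y.2 ∈ (extChartAt I₂ p.2).target := by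
  rw [extChartAt_prod, PartialEquiv.prod_target, Set.mem_prod]

theorem IsRiemannianMetric.nondegenerate {g₂ : MetricField I₂ M₂} (hg₂ : IsRiemannianMetric g₂) (x : M₂)
    (v : TangentSpace I₂ x) (hv : ∀ w, g₂ x v w = 0) : v = 0 := by
  by_contra h
  exact (hg₂.pos x v h).ne' (hv v)

theorem IsRiemannianMetric.cometric_nonneg {g₂ : MetricField I₂ M₂} (hg₂ : IsRiemannianMetric g₂) (x : M₂)
    (b : Cotangent I₂ x) : 0 ≤ cometric (g₂ x) b b := by
  by_cases h : musicalSharp (g₂ x) b = 0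
  · rw [cometric, h, map_zero]
  · exact (hg₂.pos x _ h).le

variable [IsManifold I₁ ∞ M₁] [IsManifold I₂ ∞ M₂]

/-- The product chart after a slice inclusion is a slice inclusion after the chart of `M₁`; the
chain rule is applied to both factorizations of this map. -/
theorem dChart_comp_hLift {p : M₁ × M₂} {y : E₁ × E₂}
    (hy : y ∈ (extChartAt (I₁.prod I₂) p).target) (v : E₁) :
    dChart (I₁.prod I₂) p y
      ((hLift (I₁ := I₁) (I₂ := I₂) ((extChartAt (I₁.prod I₂) p).symm y) : E₁ →L[ℝ] E₁ × E₂) v)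
      = (dChart I₁ p.1 y.1 v, 0) := by
  set x := (extChartAt (I₁.prod I₂) p).symm y with hx
  have d : MDifferentiableAt I₁ (I₁.prod I₂) (fun z => (z, x.2)) x.1 :=
    mdifferentiableAt_id.prodMk mdifferentiableAt_const
  have h1 := mfderiv_comp (I := I₁) (I' := I₁.prod I₂) (I'' := 𝓘(ℝ, E₁ × E₂)) x.1
    (mdifferentiableAt_extChartAt_of_target hy) d
  have d2 : HasFDerivAt (fun w : E₁ => (w, extChartAt I₂ p.2 x.2))
      (ContinuousLinearMap.inl ℝ E₁ E₂) (extChartAt I₁ p.1 x.1) :=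
    (hasFDerivAt_id _).prodMk (hasFDerivAt_const _ _)
  have h2 := mfderiv_comp (I := I₁) (I' := 𝓘(ℝ, E₁)) (I'' := 𝓘(ℝ, E₁ × E₂)) x.1
    (g := fun w : E₁ => (w, extChartAt I₂ p.2 x.2))
    d2.differentiableAt.mdifferentiableAt
    (mdifferentiableAt_extChartAt_of_target (mem_extChartAt_prod_target.1 hy).1)
  rw [mfderiv_eq_fderiv, d2.fderiv] at h2
  exact congrArg (fun L : E₁ →L[ℝ] E₁ × E₂ => L v) (h1.symm.trans h2)

theorem dChart_comp_vLift {p : M₁ × M₂} {y : E₁ × E₂}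
    (hy : y ∈ (extChartAt (I₁.prod I₂) p).target) (v : E₂) :
    dChart (I₁.prod I₂) p y
      ((vLift (I₁ := I₁) (I₂ := I₂) ((extChartAt (I₁.prod I₂) p).symm y) : E₂ →L[ℝ] E₁ × E₂) v)
      = (0, dChart I₂ p.2 y.2 v) := by
  set x := (extChartAt (I₁.prod I₂) p).symm y with hx
  have d : MDifferentiableAt I₂ (I₁.prod I₂) (fun z => (x.1, z)) x.2 :=
    mdifferentiableAt_const.prodMk mdifferentiableAt_id
  have h1 := mfderiv_comp (I := I₂) (I' := I₁.prod I₂) (I'' := 𝓘(ℝ, E₁ × E₂)) x.2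
    (mdifferentiableAt_extChartAt_of_target hy) d
  have d2 : HasFDerivAt (fun w : E₂ => (extChartAt I₁ p.1 x.1, w))
      (ContinuousLinearMap.inr ℝ E₁ E₂) (extChartAt I₂ p.2 x.2) :=
    (hasFDerivAt_const _ _).prodMk (hasFDerivAt_id _)
  have h2 := mfderiv_comp (I := I₂) (I' := 𝓘(ℝ, E₂)) (I'' := 𝓘(ℝ, E₁ × E₂)) x.2
    (g := fun w : E₂ => (extChartAt I₁ p.1 x.1, w))
    d2.differentiableAt.mdifferentiableAt
    (mdifferentiableAt_extChartAt_of_target (mem_extChartAt_prod_target.1 hy).2)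
  rw [mfderiv_eq_fderiv, d2.fderiv] at h2
  exact congrArg (fun L : E₂ →L[ℝ] E₁ × E₂ => L v) (h1.symm.trans h2)

theorem readSharp_warpedSharp (P₁ : SharpField I₁ M₁) (P₂ : SharpField I₂ M₂) {ν : M₁ → ℝ} {c : ℝ}
    (hν : ∀ x, ν x = c) {p : M₁ × M₂} {y : E₁ × E₂}
    (hy : y ∈ (extChartAt (I₁.prod I₂) p).target) :
    readSharp (warpedSharp P₁ ν P₂) p y
      = prodSharp (readSharp P₁ p.1) c (readSharp P₂ p.2) y := by
  obtain rfl : ν = fun _ => c := funext hν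
  refine ContinuousLinearMap.ext fun α => ?_
  let h : E₁ →L[ℝ] E₁ × E₂ :=
    hLift (I₁ := I₁) (I₂ := I₂) ((extChartAt (I₁.prod I₂) p).symm y)
  let u : E₂ →L[ℝ] E₁ × E₂ :=
    vLift (I₁ := I₁) (I₂ := I₂) ((extChartAt (I₁.prod I₂) p).symm y)
  have e : readSharp (warpedSharp P₁ (fun _ => c) P₂) p y α = dChart (I₁.prod I₂) p y
      (h (modelSharp P₁ ((extChartAt I₁ p.1).symm y.1) ((α.comp (dChart (I₁.prod I₂) p y)).comp h))
        + c • u (modelSharp P₂ ((extChartAt I₂ p.2).symm y.2)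
          ((α.comp (dChart (I₁.prod I₂) p y)).comp u))) := rfl
  have hh : ∀ v, dChart (I₁.prod I₂) p y (h v) = (dChart I₁ p.1 y.1 v, 0) := dChart_comp_hLift hy
  have hu : ∀ v, dChart (I₁.prod I₂) p y (u v) = (0, dChart I₂ p.2 y.2 v) := dChart_comp_vLift hy
  have ch : (α.comp (dChart (I₁.prod I₂) p y)).comp h
      = (α.comp (ContinuousLinearMap.inl ℝ E₁ E₂)).comp (dChart I₁ p.1 y.1) := by
    ext v; exact congrArg α (hh v)
  have cu : (α.comp (dChart (I₁.prod I₂) p y)).comp u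
      = (α.comp (ContinuousLinearMap.inr ℝ E₁ E₂)).comp (dChart I₂ p.2 y.2) := by
    ext v; exact congrArg α (hu v)
  rw [e, map_add, map_smul, hh, hu, ch, cu, prodSharp_apply, readSharp_apply, readSharp_apply]
  simp

variable [I₁.Boundaryless] [I₂.Boundaryless]

/-- The chain rule is applied to the two factorizations of one map: inverse product chart then
projection, and linear projection then inverse chart of `M₁`. -/
theorem dFst_comp_dChartSymm {p : M₁ × M₂} {y : E₁ × E₂}
    (hy : y ∈ (extChartAt (I₁.prod I₂) p).target) (v : E₁ × E₂) :
    (dFst (I₁ := I₁) (I₂ := I₂) ((extChartAt (I₁.prod I₂) p).symm y) : E₁ × E₂ →L[ℝ] E₁)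
      (dChartSymm (I₁.prod I₂) p y v) = dChartSymm I₁ p.1 y.1 v.1 := by
  have h1 := mfderiv_comp (I' := I₁.prod I₂) (I'' := I₁) y
    (mdifferentiableAt_fst (I := I₁) (I' := I₂) (x := (extChartAt (I₁.prod I₂) p).symm y))
    (mdifferentiableAt_extChartAt_symm hy)
  have h2 := mfderiv_comp (I := 𝓘(ℝ, E₁ × E₂)) (I' := 𝓘(ℝ, E₁)) (I'' := I₁) (f := Prod.fst) y
    (mdifferentiableAt_extChartAt_symm (mem_extChartAt_prod_target.1 hy).1)
    differentiableAt_fst.mdifferentiableAt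
  rw [mfderiv_eq_fderiv, fderiv_fst] at h2
  exact congrArg (fun L : E₁ × E₂ →L[ℝ] E₁ => L v) (h1.symm.trans h2)

theorem dSnd_comp_dChartSymm {p : M₁ × M₂} {y : E₁ × E₂}
    (hy : y ∈ (extChartAt (I₁.prod I₂) p).target) (v : E₁ × E₂) :
    (dSnd (I₁ := I₁) (I₂ := I₂) ((extChartAt (I₁.prod I₂) p).symm y) : E₁ × E₂ →L[ℝ] E₂)
      (dChartSymm (I₁.prod I₂) p y v) = dChartSymm I₂ p.2 y.2 v.2 := by
  have h1 := mfderiv_comp (I' := I₁.prod I₂) (I'' := I₂) y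
    (mdifferentiableAt_snd (I := I₁) (I' := I₂) (x := (extChartAt (I₁.prod I₂) p).symm y))
    (mdifferentiableAt_extChartAt_symm hy)
  have h2 := mfderiv_comp (I := 𝓘(ℝ, E₁ × E₂)) (I' := 𝓘(ℝ, E₂)) (I'' := I₂) (f := Prod.snd) y
    (mdifferentiableAt_extChartAt_symm (mem_extChartAt_prod_target.1 hy).2)
    differentiableAt_snd.mdifferentiableAt
  rw [mfderiv_eq_fderiv, fderiv_snd] at h2
  exact congrArg (fun L : E₁ × E₂ →L[ℝ] E₂ => L v) (h1.symm.trans h2)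

theorem readMetric_warpedMetric (g₁ : MetricField I₁ M₁) (f : M₁ → ℝ) (g₂ : MetricField I₂ M₂)
    {p : M₁ × M₂} {y : E₁ × E₂} (hy : y ∈ (extChartAt (I₁.prod I₂) p).target) :
    readMetric (warpedMetric g₁ f g₂) p y
      = prodMetric (readMetric g₁ p.1) (fun z => f ((extChartAt I₁ p.1).symm z))
        (readMetric g₂ p.2) y := by
  refine ContinuousLinearMap.ext fun v => ContinuousLinearMap.ext fun w => ?_
  rw [prodMetric_apply, readMetric_apply, readMetric_apply g₁, readMetric_apply g₂,
    ← dFst_comp_dChartSymm hy, ← dFst_comp_dChartSymm hy, ← dSnd_comp_dChartSymm hy,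
    ← dSnd_comp_dChartSymm hy]
  rfl

theorem readCovector_hCovector (p : M₁ × M₂) (a : Cotangent I₁ p.1) :
    readCovector (I := I₁.prod I₂) p (hCovector p a)
      = (readCovector p.1 a).comp (ContinuousLinearMap.fst ℝ E₁ E₂) := by
  have hy := mem_extChartAt_target (I := I₁.prod I₂) p
  have hp := extChartAt_to_inv (I := I₁.prod I₂) p
  let a' : E₁ →L[ℝ] ℝ := a
  let d : M₁ × M₂ → (E₁ × E₂ →L[ℝ] E₁) := fun x => dFst (I₁ := I₁) (I₂ := I₂) x
  refine ContinuousLinearMap.ext fun v => ?_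
  have h := dFst_comp_dChartSymm hy v
  have hd : d ((extChartAt (I₁.prod I₂) p).symm (extChartAt (I₁.prod I₂) p p)) = d p := by rw [hp]
  have h' : d p (dChartSymm (I₁.prod I₂) p (extChartAt (I₁.prod I₂) p p) v)
      = dChartSymm I₁ p.1 (extChartAt (I₁.prod I₂) p p).1 v.1 := by rw [← hd]; exact h
  exact congrArg a' h'

theorem readCovector_vCovector (p : M₁ × M₂) (b : Cotangent I₂ p.2) :
    readCovector (I := I₁.prod I₂) p (vCovector p b)
      = (readCovector p.2 b).comp (ContinuousLinearMap.snd ℝ E₁ E₂) := by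
  have hy := mem_extChartAt_target (I := I₁.prod I₂) p
  have hp := extChartAt_to_inv (I := I₁.prod I₂) p
  let b' : E₂ →L[ℝ] ℝ := b
  let d : M₁ × M₂ → (E₁ × E₂ →L[ℝ] E₂) := fun x => dSnd (I₁ := I₁) (I₂ := I₂) x
  refine ContinuousLinearMap.ext fun v => ?_
  have h := dSnd_comp_dChartSymm hy v
  have hd : d ((extChartAt (I₁.prod I₂) p).symm (extChartAt (I₁.prod I₂) p p)) = d p := by rw [hp]
  have h' : d p (dChartSymm (I₁.prod I₂) p (extChartAt (I₁.prod I₂) p p) v)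
      = dChartSymm I₂ p.2 (extChartAt (I₁.prod I₂) p p).2 v.2 := by rw [← hd]; exact h
  exact congrArg b' h'

variable {g₁ : MetricField I₁ M₁} {P₁ : SharpField I₁ M₁} {f : M₁ → ℝ}
  {g₂ : MetricField I₂ M₂} {P₂ : SharpField I₂ M₂} {ν : M₁ → ℝ} {c : ℝ} {p : M₁ × M₂}

/-- The coordinate expressions agree with the local model on the whole chart target, an open
neighbourhood of the point, and the curvature depends only on germs there. -/
theorem sectionalCurvature_warped (hν : ∀ x, ν x = c) (a b : Cotangent (I₁.prod I₂) p) :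
    sectionalCurvature (warpedMetric g₁ f g₂) (warpedSharp P₁ ν P₂) p a b
      = sectional (prodMetric (readMetric g₁ p.1) (fun z => f ((extChartAt I₁ p.1).symm z))
          (readMetric g₂ p.2)) (prodSharp (readSharp P₁ p.1) c (readSharp P₂ p.2))
        (extChartAt I₁ p.1 p.1, extChartAt I₂ p.2 p.2) (readCovector p a) (readCovector p b) := by
  have hm := (isOpen_extChartAt_target (I := I₁.prod I₂) p).mem_nhds
    (mem_extChartAt_target (I := I₁.prod I₂) p)
  refine sectional_congr ?_ ?_ _ _
  · filter_upwards [hm] with y hy using readMetric_warpedMetric g₁ f g₂ hy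
  · filter_upwards [hm] with y hy using readSharp_warpedSharp P₁ P₂ hν hy

variable [FiniteDimensional ℝ E₁] [FiniteDimensional ℝ E₂] {q₁ : ℕ}

theorem isWarpedAt_read (hg₁ : IsPseudoRiemannianMetric g₁ q₁) (hP₁ : IsPoisson P₁)
    (hf : ContMDiff I₁ 𝓘(ℝ, ℝ) ∞ f) (hf0 : ∀ x, 0 < f x) (hg₂ : IsRiemannianMetric g₂)
    (hP₂ : IsPoisson P₂) (p : M₁ × M₂) :
    IsWarpedAt (readMetric g₁ p.1) (readSharp P₁ p.1) (fun z => f ((extChartAt I₁ p.1).symm z))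
      (readMetric g₂ p.2) (readSharp P₂ p.2) (extChartAt I₁ p.1 p.1, extChartAt I₂ p.2 p.2) where
  left := isSmoothPair_read hg₁.smooth hg₁.nondegenerate hP₁.smooth p.1
  right := isSmoothPair_read hg₂.smooth hg₂.nondegenerate hP₂.smooth p.2
  eventually_smooth := by
    filter_upwards [(isOpen_extChartAt_target (I := I₁) p.1).mem_nhds
      (mem_extChartAt_target (I := I₁) p.1)] with y hy using contDiffAt_read hf hy
  ne_zero := (hf0 _).ne'

theorem sectionalCurvature_horizontal (hg₁ : IsPseudoRiemannianMetric g₁ q₁) (hP₁ : IsPoisson P₁)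
    (hf : ContMDiff I₁ 𝓘(ℝ, ℝ) ∞ f) (hf0 : ∀ x, 0 < f x) (hg₂ : IsRiemannianMetric g₂)
    (hP₂ : IsPoisson P₂) (hν : ∀ x, ν x = c) (a b : Cotangent I₁ p.1) :
    sectionalCurvature (warpedMetric g₁ f g₂) (warpedSharp P₁ ν P₂) p (hCovector p a)
      (hCovector p b) = sectionalCurvature g₁ P₁ p.1 a b := by
  rw [sectionalCurvature_warped hν, readCovector_hCovector, readCovector_hCovector,
    (isWarpedAt_read hg₁ hP₁ hf hf0 hg₂ hP₂ p).sectional_fst]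
  rfl

theorem sectionalCurvature_mixed (hg₁ : IsPseudoRiemannianMetric g₁ q₁) (hP₁ : IsPoisson P₁)
    (hf : ContMDiff I₁ 𝓘(ℝ, ℝ) ∞ f) (hf0 : ∀ x, 0 < f x) (hg₂ : IsRiemannianMetric g₂)
    (hP₂ : IsPoisson P₂) (hν : ∀ x, ν x = c) {a : Cotangent I₁ p.1} {b : Cotangent I₂ p.2}
    (ha : cometric (g₁ p.1) a a = -1) (hb : cometric (g₂ p.2) b b = 1) :
    sectionalCurvature (warpedMetric g₁ f g₂) (warpedSharp P₁ ν P₂) p (hCovector p a)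
      (f p.1 • vCovector p b) = contravariantHessian g₁ P₁ f p.1 a a / f p.1
        + 2 * cometric (g₁ p.1) (endoJ (g₁ p.1) (P₁ p.1) (differential I₁ f p.1)) a ^ 2
          / f p.1 ^ 2 := by
  have hw := isWarpedAt_read hg₁ hP₁ hf hf0 hg₂ hP₂ p
  have hfp : f ((extChartAt I₁ p.1).symm (extChartAt I₁ p.1 p.1)) = f p.1 := by
    rw [extChartAt_to_inv]
  have hv : readCovector (I := I₁.prod I₂) p (f p.1 • vCovector p b)
      = (f p.1 • readCovector p.2 b).comp (ContinuousLinearMap.snd ℝ E₁ E₂) := by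
    rw [ContinuousLinearMap.smul_comp, ← readCovector_vCovector (I₁ := I₁)]; rfl
  have hJ := endoJ_read (I := I₁) g₁ P₁ p.1 (differential I₁ f p.1)
  have hs : ∀ v w, readMetric g₁ p.1 (extChartAt I₁ p.1 p.1) v w
      = readMetric g₁ p.1 (extChartAt I₁ p.1 p.1) w v := fun v w => hg₁.symm _ _ _
  -- Skewness of the coordinate bivector is skewness on `M₁` for the covectors pulled back by the
  -- chart; with `cometric_endoJ` it gives `g̃₁(J₁df, a) = -df(♯₁a)`.
  have hk : ∀ α β : E₁ →L[ℝ] ℝ, bivector (readSharp P₁ p.1 (extChartAt I₁ p.1 p.1)) α β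
      = -bivector (readSharp P₁ p.1 (extChartAt I₁ p.1 p.1)) β α := fun α β => by
    let α' : E₁ →L[ℝ] ℝ := α.comp (dChart I₁ p.1 (extChartAt I₁ p.1 p.1))
    let β' : E₁ →L[ℝ] ℝ := β.comp (dChart I₁ p.1 (extChartAt I₁ p.1 p.1))
    exact hP₁.skew _ α' β'
  rw [sectionalCurvature_warped hν, readCovector_hCovector, hv,
    hw.sectional_fst_snd c ((cometric_read hg₁.nondegenerate p.1 a a).trans ha)]
  · simp only [hfp, contravariantHessian]
    rw [fderiv_read hf, hJ, cometric_read hg₁.nondegenerate]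
  · simp only [hfp]
    rw [cometric_smul_left, cometric_smul_right, cometric_read hg₂.nondegenerate, hb]
    ring
  · simp only
    rw [cometric_endoJ hw.left.invertible hs, hk]
    rfl

end ProductCharts

end ContravariantGeometry

end

/-! ### Summation over the coframe. -/

open ContravariantGeometry in
theorem corollary4p4
    {E₁ : Type*} [NormedAddCommGroup E₁] [NormedSpace ℝ E₁] [FiniteDimensional ℝ E₁]
    {H₁ : Type*} [TopologicalSpace H₁] (I₁ : ModelWithCorners ℝ E₁ H₁) [I₁.Boundaryless]
    {M₁ : Type*} [TopologicalSpace M₁] [ChartedSpace H₁ M₁] [IsManifold I₁ ∞ M₁]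
    (g₁ : MetricField I₁ M₁) (q₁ : ℕ) (hg₁ : IsPseudoRiemannianMetric g₁ q₁)
    (P₁ : SharpField I₁ M₁) (hP₁ : IsPoisson P₁)
    (f₁ : M₁ → ℝ) (hf₁ : ContMDiff I₁ 𝓘(ℝ, ℝ) ∞ f₁) (hf₁pos : ∀ x, 0 < f₁ x)
    (p₁ : M₁) (dx : Fin (Module.finrank ℝ E₁) → Cotangent I₁ p₁)
    (hdx : IsOrthonormalCoframe g₁ p₁ q₁ dx) :
    ∃ Q₀ : ℕ → ℝ,
      (∀ k₂ : ℕ, Q₀ k₂ =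
        2 * ∑ i : Fin (Module.finrank ℝ E₁) with i.val < q₁,
            ∑ s : Fin (Module.finrank ℝ E₁) with q₁ ≤ s.val,
              sectionalCurvature g₁ P₁ p₁ (dx i) (dx s)
          + 2 * k₂ / f₁ p₁ *
            ∑ i : Fin (Module.finrank ℝ E₁) with i.val < q₁, contravariantHessian g₁ P₁ f₁ p₁ (dx i) (dx i)
          + 4 * k₂ / f₁ p₁ ^ 2 *
            ∑ i : Fin (Module.finrank ℝ E₁) with i.val < q₁,
              |cometric (g₁ p₁) (endoJ (g₁ p₁) (P₁ p₁) (differential I₁ f₁ p₁)) (dx i)| ^ 2) ∧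
      ∀ {E₂ : Type*} [NormedAddCommGroup E₂] [NormedSpace ℝ E₂] [FiniteDimensional ℝ E₂]
        {H₂ : Type*} [TopologicalSpace H₂] (I₂ : ModelWithCorners ℝ E₂ H₂) [I₂.Boundaryless]
        {M₂ : Type*} [TopologicalSpace M₂] [ChartedSpace H₂ M₂] [IsManifold I₂ ∞ M₂]
        (g₂ : MetricField I₂ M₂) (_ : IsRiemannianMetric g₂)
        (P₂ : SharpField I₂ M₂) (_ : IsPoisson P₂)
        (ν₁ : M₁ → ℝ) (_ : ∃ c : ℝ, ∀ x, ν₁ x = c)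
        (p₂ : M₂) (q₂ : ℕ) (dy : Fin (Module.finrank ℝ E₂) → Cotangent I₂ p₂)
        (_ : IsOrthonormalCoframe g₂ p₂ q₂ dy),
        qualarCurvature g₁ P₁ f₁ ν₁ g₂ P₂ (p₁, p₂) q₁ q₂ dx dy = Q₀ (Module.finrank ℝ E₂) := by
  -- `Q₀` is read off from its defining formula by unification. It is fixed before any data on `M₂`
  -- or `ν₁` are introduced, which is the asserted independence.
  refine ⟨fun k₂ => _, fun k₂ => rfl, ?_⟩
  intro E₂ _ _ _ H₂ _ I₂ _ M₂ _ _ _ g₂ hg₂ P₂ hP₂ ν₁ hν p₂ q₂ dy hdy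
  obtain ⟨c, hν⟩ := hν
  -- A timelike member of the coframe would have norm `-1`, against positivity of the cometric. The
  -- claim concerns indices rather than `q₂ = 0`, since `q₂` is unconstrained when `M₂` has
  -- dimension zero.
  have hq₂ : ∀ s : Fin (Module.finrank ℝ E₂), ¬ s.val < q₂ := fun s hs => by
    have h1 := hdy s s
    rw [if_pos rfl, if_pos hs] at h1
    linarith [hg₂.cometric_nonneg p₂ (dy s)]
  have hdy1 : ∀ s, cometric (g₂ p₂) (dy s) (dy s) = 1 := fun s => by
    rw [hdy s s, if_pos rfl, if_neg (hq₂ s)]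
  -- This removes the last two double sums, while `hfull` lets the mixed sum run over the entire
  -- fibre coframe and so produces the factor `k₂`.
  have hempty : ({i : Fin (Module.finrank ℝ E₂) | i.val < q₂} : Finset _) = ∅ :=
    Finset.filter_eq_empty_iff.2 fun s _ => hq₂ s
  have hfull : ({s : Fin (Module.finrank ℝ E₂) | q₂ ≤ s.val} : Finset _) = Finset.univ :=
    Finset.filter_eq_self.2 fun s _ => not_lt.1 (hq₂ s)
  have hX : ∀ i s, sectionalCurvature (warpedMetric g₁ f₁ g₂) (warpedSharp P₁ ν₁ P₂) (p₁, p₂)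
      (hCovector (p₁, p₂) (dx i)) (hCovector (p₁, p₂) (dx s))
      = sectionalCurvature g₁ P₁ p₁ (dx i) (dx s) := fun i s =>
    sectionalCurvature_horizontal (p := (p₁, p₂)) hg₁ hP₁ hf₁ hf₁pos hg₂ hP₂ hν _ _
  have hY : ∀ i ∈ ({i : Fin (Module.finrank ℝ E₁) | i.val < q₁} : Finset _),
      ∑ s : Fin (Module.finrank ℝ E₂), sectionalCurvature (warpedMetric g₁ f₁ g₂)
        (warpedSharp P₁ ν₁ P₂) (p₁, p₂) (hCovector (p₁, p₂) (dx i))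
        (f₁ p₁ • vCovector (p₁, p₂) (dy s))
      = Module.finrank ℝ E₂ * (contravariantHessian g₁ P₁ f₁ p₁ (dx i) (dx i) / f₁ p₁
        + 2 * |cometric (g₁ p₁) (endoJ (g₁ p₁) (P₁ p₁) (differential I₁ f₁ p₁)) (dx i)| ^ 2
          / f₁ p₁ ^ 2) := fun i hi => by
    have hdx1 : cometric (g₁ p₁) (dx i) (dx i) = -1 := by
      rw [hdx i i, if_pos rfl, if_pos (Finset.mem_filter.1 hi).2]
    have h := fun s => sectionalCurvature_mixed (p := (p₁, p₂)) hg₁ hP₁ hf₁ hf₁pos hg₂ hP₂ hν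
      hdx1 (hdy1 s)
    rw [Finset.sum_congr rfl fun s _ => h s, Finset.sum_const, Finset.card_univ, Fintype.card_fin,
      nsmul_eq_mul, sq_abs]
  simp only [qualarCurvature, hempty, hfull, hX, Finset.sum_empty, mul_zero, add_zero]
  rw [Finset.sum_congr rfl hY, ← Finset.mul_sum, Finset.sum_add_distrib, ← Finset.sum_div,
    ← Finset.sum_div, ← Finset.mul_sum]
  ring
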